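/- **Setting.** Let $s=d_0$, $N_{\rm obs}=d_{L+1}$, $L\ge 1$, $Y=[0,1]^s$, and let $\theta=(W_\ell,v_\ell)_{\ell=0}^L$ with $W_\ell\in\mathbb R^{d_{\ell+1}\times d_\ell}$, $v_\ell\in\mathbb R^{d_{\ell+1}}$. The non-periodic DNN is defined by $G^{[0]}_\theta(y)=W_0y+v_0$, $G_\theta^{[\ell]}(y)=W_\ell\,\sigma(G_\theta^{[\ell-1]}(y))+v_\ell$ for $\ell\ge1$ ($\sigma$ acts componentwise); the periodic DNN is defined by the same recursion started from $G^{[0]}_\theta(y)=W_0\sin(2\pi y)+v_0$. Let $\beta_j,R_\ell,\xi,\tau>0$ be such that $$\max_p|W_{0,p,j}|\le\beta_j\ (1\le j\le s),\qquad \max_p\sum_q|W_{\ell,p,q}|\le R_\ell\ (1\le\ell\le L),$$ and let the activation $\sigma\in C^\infty(\mathbb R)$ satisfy $\sup_{x\in\mathbb R}|\sigma^{(n)}(x)|\le\xi\,\tau^n\,n!$ for all $n\ge1$. Put $P_k=\prod_{t=1}^k(\xi\tau R_t)$ (so $P_0=1$), $S_L=\tau\sum_{k=0}^{L-1}P_k$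 and $C_L=\max\{\|G_\theta^{[L]}\|_\infty,\,P_L/S_L\}$, where $\|G_\theta^{[L]}\|_\infty=\sup_{y\in Y}\max_p|G^{[L]}_\theta(y)_p|$ for the DNN under consideration. For a multiindex $\nu\in\mathbb N_0^s$ write $|\nu|=\sum_j\nu_j$ and $b^\nu=\prod_j b_j^{\nu_j}$; $\mathcal S(n,k)$ are the Stirling numbers of the second kind, and $\mathcal S(\nu,m)=\prod_j\mathcal S(\nu_j,m_j)$. For weights $\gamma_{\mathfrak u}>0$, $\mathfrak u\subseteq\{1{:}s\}$, an integer $\alpha\ge1$ and smooth $F$, let $$D_{\mathfrak u}F(y_{\mathfrak u})=\int_{[0,1]^{s-|\mathfrak u|}}\Big(\prod_{j\in\mathfrak u}\partial_{y_j}^{\alpha}\Big)F(y)\,dy_{\{1:s\}\setminus\mathfrak u},\qquad \|F\|_{\mathcal W_{\alpha,\gamma}}^2=\sum_{\mathfrak u}\frac1{\gamma_{\mathfrak u}}\int_{[0,1]^{|\mathfrak u|}}|D_{\mathfrak u}F|^2\,dy_{\mathfrak u},$$ $$\|F\|_{\mathcal K_{\alpha,\gamma}}=\sup_{h\in\mathbb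 Z^s}\frac{1}{\gamma_{{\rm supp}(h)}}\prod_{j\in{\rm supp}(h)}(2\pi|h_j|)^{\alpha}\,\big|\widehat F(h)\big|,\qquad M_{\alpha,\gamma}(F)=\max_{\mathfrak u}\frac1{\gamma_{\mathfrak u}}\int_{[0,1]^{|\mathfrak u|}}|D_{\mathfrak u}F|\,dy_{\mathfrak u},$$ where $\widehat F(h)=\int_Y F(y)e^{-2\pi i h\cdot y}\,dy$ and ${\rm supp}(h)=\{j:h_j\ne0\}$. **Theorem (Match regularity of DNNs to observables).** Given $(b_j)$, $C>0$ and $\rho>0$, assume $R_\ell\le\rho$ for $\ell=1,\dots,L-1$, and $\beta_j\le b_j/S_L$ for $j=1,\dots,s$. Then $S_L\le\tau L$ if $\xi\tau\rho=1$, and $S_L\le\tau\frac{(\xi\tau\rho)^L-1}{\xi\tau\rho-1}$ otherwise. Moreover: (a) Suppose that $C_L\le C$ for the non-periodic DNN $G^{[L]}_\theta$. Then $F=G^{[L]}_\theta$ is smooth on $Y$ and satisfies $$|\partial^\nu F(y)_p|\le C\,|\nu|!\,b^\nu\qquad\text{for all } \nu\in\mathbb N_0^s,\ 1\le p\le N_{\rm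 obs},\ y\in Y. \tag{1}$$ If a target function $G:Y\to\mathbb R^{N_{\rm obs}}$ that is smooth on $Y$ also satisfies (1), then for all $p$ $$\max\{\|G(\cdot)_p\|^2_{\mathcal W_{1,\gamma}},\|G^{[L]}_\theta(\cdot)_p\|^2_{\mathcal W_{1,\gamma}}\}\le C^2\sum_{\mathfrak u}\frac1{\gamma_{\mathfrak u}}\Big(|\mathfrak u|!\prod_{j\in\mathfrak u}b_j\Big)^2,$$ $$\|(G(\cdot)_p-G^{[L]}_\theta(\cdot)_p)^2\|^2_{\mathcal W_{1,\gamma}}\le16\,C^4\sum_{\mathfrak u}\frac1{\gamma_{\mathfrak u}}\Big((|\mathfrak u|+1)!\prod_{j\in\mathfrak u}b_j\Big)^2.$$ (b) Suppose that $C_L\le C$ for the periodic DNN $G^{[L]}_\theta$. Then $F=G^{[L]}_\theta$ is smooth, one-periodic in each variable, and satisfies $$|\partial^\nu F(y)_p|\le C\,(2\pi)^{|\nu|}\sum_{m\le\nu}|m|!\,b^m\,\mathcal S(\nu,m)\qquad\text{for all } \nu\in\mathbb N_0^s,\ 1\le p\le N_{\rm obs},\ y\in Y. \tag{2}$$ If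 a smooth target function $G:\mathbb R^s\to\mathbb R^{N_{\rm obs}}$ that is one-periodic in each variable also satisfies (2), then for every integer $\alpha\ge1$ and all $p$, with $$\Sigma_k(\mathfrak u)=\sum_{m_{\mathfrak u}\le\alpha_{\mathfrak u}}(|m_{\mathfrak u}|+k)!\prod_{j\in\mathfrak u}\big(\mathcal S(\alpha,m_j)\,b_j^{m_j}\big),\qquad \alpha_{\mathfrak u}=(\alpha,\dots,\alpha),\quad k\in\{0,1\},$$ $$\max\{\|G(\cdot)_p\|^2_{\mathcal W_{\alpha,\gamma}},\|G^{[L]}_\theta(\cdot)_p\|^2_{\mathcal W_{\alpha,\gamma}}\}\le C^2\sum_{\mathfrak u}\frac{(2\pi)^{2\alpha|\mathfrak u|}}{\gamma_{\mathfrak u}}\,\Sigma_0(\mathfrak u)^2,$$ $$\|(G(\cdot)_p-G^{[L]}_\theta(\cdot)_p)^2\|^2_{\mathcal W_{\alpha,\gamma}}\le16\,C^4\sum_{\mathfrak u}\frac{(2\pi)^{2\alpha|\mathfrak u|}}{\gamma_{\mathfrak u}}\,\Sigma_1(\mathfrak u)^2.$$ (c) In the situation of (b), for every integer $\alpha\ge2$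 and all $p$, $$\max\{\|G(\cdot)_p\|_{\mathcal K_{\alpha,\gamma}},\|G^{[L]}_\theta(\cdot)_p\|_{\mathcal K_{\alpha,\gamma}}\}\le C\max_{\mathfrak u}\frac{(2\pi)^{\alpha|\mathfrak u|}}{\gamma_{\mathfrak u}}\,\Sigma_0(\mathfrak u),$$ $$\|(G(\cdot)_p-G^{[L]}_\theta(\cdot)_p)^2\|_{\mathcal K_{\alpha,\gamma}}\le4\,C^2\max_{\mathfrak u}\frac{(2\pi)^{\alpha|\mathfrak u|}}{\gamma_{\mathfrak u}}\,\Sigma_1(\mathfrak u),$$ and the same two bounds hold with $M_{\alpha,\gamma}(\cdot)$ in place of $\|\cdot\|_{\mathcal K_{\alpha,\gamma}}$. -/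

import Mathlib

open MeasureTheory Set
open scoped ContDiff ENNReal Nat Matrix

noncomputable section

namespace DNNReg

/-! ### Networks -/

/-- Network parameters: weight matrices `W ℓ ∈ ℝ^{d (ℓ+1) × d ℓ}` and bias vectors
`v ℓ ∈ ℝ^{d (ℓ+1)}`.  A network of depth `L` uses the layers `ℓ = 0, …, L` only. -/
structure NetParams (d : ℕ → ℕ) where
  W : ∀ ℓ : ℕ, Matrix (Fin (d (ℓ + 1))) (Fin (d ℓ)) ℝ
  v : ∀ ℓ : ℕ, Fin (d (ℓ + 1)) → ℝ

/-- The non-periodic network, by recursion on the depth: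
`G^{[0]}(y) = W₀ y + v₀`, `G^{[ℓ]}(y) = W_ℓ σ(G^{[ℓ-1]}(y)) + v_ℓ`, with `σ` applied
componentwise. -/
def dnn {d : ℕ → ℕ} (θ : NetParams d) (σ : ℝ → ℝ) :
    (ℓ : ℕ) → (Fin (d 0) → ℝ) → (Fin (d (ℓ + 1)) → ℝ)
  | 0, y => θ.W 0 *ᵥ y + θ.v 0
  | ℓ + 1, y => θ.W (ℓ + 1) *ᵥ (fun q => σ (dnn θ σ ℓ y q)) + θ.v (ℓ + 1)

/-- The periodic network: the input `y` is replaced by `sin (2π y)`, componentwise. -/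
def periodicDnn {d : ℕ → ℕ} (θ : NetParams d) (σ : ℝ → ℝ) (ℓ : ℕ)
    (y : Fin (d 0) → ℝ) : Fin (d (ℓ + 1)) → ℝ :=
  dnn θ σ ℓ (fun j => Real.sin (2 * Real.pi * y j))

/-! ### Functions on the unit cube and their mixed derivatives -/

/-- The parameter domain `Y = [0,1]^s`. -/
def unitCube (s : ℕ) : Set (Fin s → ℝ) := Icc 0 1

/-- `‖F‖_∞`: the supremum over `Y` of the largest component in absolute value (the norm of
`Fin N → ℝ` is the maximum norm). -/
def cubeSupNorm {s N : ℕ} (F : (Fin s → ℝ) → (Fin N → ℝ)) : ℝ :=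
  ⨆ y : unitCube s, ‖F y‖

/-- The partial derivative `∂/∂y_j` on `Y = [0,1]^s` (one-sided where `y_j` is `0` or `1`). -/
def partialDeriv {s : ℕ} (j : Fin s) (F : (Fin s → ℝ) → ℝ) : (Fin s → ℝ) → ℝ :=
  fun y => derivWithin (fun t : ℝ => F (Function.update y j t)) (Icc 0 1) (y j)

/-- The mixed partial derivative `∂^ν = ∏_j (∂/∂y_j)^{ν_j}` on `Y`. -/
def mixedDeriv {s : ℕ} (ν : Fin s → ℕ) (F : (Fin s → ℝ) → ℝ) : (Fin s → ℝ) → ℝ :=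
  (List.finRange s).foldr (fun j g => (partialDeriv j)^[ν j] g) F

/-- The product and order dependent (POD) quantity `|ν|! b^ν`, with `(|ν| + k)!` in place of
`|ν|!`. -/
def podBound {ι : Type*} [Fintype ι] (k : ℕ) (ν : ι → ℕ) (b : ι → ℝ) : ℝ :=
  (((∑ j, ν j) + k)! : ℝ) * ∏ j, b j ^ ν j

/-- The smoothness-driven POD (SPOD) sum `∑_{m ≤ ν} |m|! S(ν,m) b^m`, with `(|m| + k)!` in place
of `|m|!`; `S(ν,m) = ∏_j S(ν_j,m_j)` with Stirling numbers of the second kind. -/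
def spodSum {ι : Type*} [Fintype ι] [DecidableEq ι] (k : ℕ) (ν : ι → ℕ) (b : ι → ℝ) : ℝ :=
  ∑ m ∈ Finset.Iic ν,
    (((∑ j, m j) + k)! : ℝ) * (∏ j, (Nat.stirlingSecond (ν j) (m j) : ℝ)) * ∏ j, b j ^ m j

/-- `F` is smooth on the closed cube and obeys `|∂^ν F(y)_p| ≤ C |ν|! b^ν` there, for all
multiindices `ν` and all components `p`. -/
def HasPODBound {s N : ℕ} (C : ℝ) (b : Fin s → ℝ) (F : (Fin s → ℝ) → (Fin N → ℝ)) : Prop :=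
  ContDiffOn ℝ ∞ F (unitCube s) ∧
    ∀ (ν : Fin s → ℕ) (p : Fin N), ∀ y ∈ unitCube s,
      |mixedDeriv ν (fun x => F x p) y| ≤ C * podBound 0 ν b

/-- `F` is smooth, one-periodic in each variable, and obeys
`|∂^ν F(y)_p| ≤ C (2π)^{|ν|} ∑_{m ≤ ν} |m|! b^m S(ν,m)` for all multiindices `ν` and all
components `p`. -/
def HasPeriodicSPODBound {s N : ℕ} (C : ℝ) (b : Fin s → ℝ)
    (F : (Fin s → ℝ) → (Fin N → ℝ)) : Prop :=
  ContDiff ℝ ∞ F ∧ (∀ (j : Fin s) (y : Fin s → ℝ), F (y + Pi.single j 1) = F y) ∧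
    ∀ (ν : Fin s → ℕ) (p : Fin N), ∀ y ∈ unitCube s,
      |mixedDeriv ν (fun x => F x p) y| ≤ C * (2 * Real.pi) ^ (∑ j, ν j) * spodSum 0 ν b

/-! ### Weighted norms -/

/-- The point of `ℝ^s` with coordinates `y` on `u` and `z` off `u`. -/
def merge {s : ℕ} (u : Finset (Fin s)) (y : {j // j ∈ u} → ℝ) (z : {j // j ∉ u} → ℝ) :
    Fin s → ℝ :=
  fun j => if h : j ∈ u then y ⟨j, h⟩ else z ⟨j, h⟩

/-- `∫_{[0,1]^{s-|u|}} ∂^{ν_u} F dy_{{1:s} \ u}` with `ν_u = (α,…,α)`, a function of `y_u`. -/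
def projDeriv {s : ℕ} (α : ℕ) (u : Finset (Fin s)) (F : (Fin s → ℝ) → ℝ)
    (y : {j // j ∈ u} → ℝ) : ℝ :=
  ∫ z in Icc (0 : {j // j ∉ u} → ℝ) 1,
    mixedDeriv (fun j => if j ∈ u then α else 0) F (merge u y z)

/-- The norm of the weighted space `W_{α,γ}`: the unanchored Sobolev norm for `α = 1`, and the
Hilbert Korobov norm on periodic functions. -/
def sobolevNorm {s : ℕ} (α : ℕ) (γ : Finset (Fin s) → ℝ) (F : (Fin s → ℝ) → ℝ) : ℝ :=
  Real.sqrt (∑ u : Finset (Fin s),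
    (1 / γ u) * ∫ y in Icc (0 : {j // j ∈ u} → ℝ) 1, |projDeriv α u F y| ^ 2)

/-- The Fourier coefficient `∫_{[0,1]^s} F(y) e^{-2πi h·y} dy`. -/
def cubeFourierCoeff {s : ℕ} (F : (Fin s → ℝ) → ℝ) (h : Fin s → ℤ) : ℂ :=
  ∫ y in unitCube s,
    (F y : ℂ) * Complex.exp (-(2 * Real.pi * Complex.I * ∑ j, (h j : ℂ) * (y j : ℂ)))

/-- The norm of the non-Hilbert weighted Korobov space `K_{α,γ}`:
`sup_h γ_{supp h}⁻¹ ∏_{j ∈ supp h} (2π|h_j|)^α |F̂(h)|`, equal to `∞` off the space. -/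
def korobovNorm {s : ℕ} (α : ℕ) (γ : Finset (Fin s) → ℝ) (F : (Fin s → ℝ) → ℝ) : ℝ≥0∞ :=
  ⨆ h : Fin s → ℤ, ENNReal.ofReal
    ((1 / γ (Finset.univ.filter fun j => h j ≠ 0)) *
      (∏ j ∈ Finset.univ.filter (fun j => h j ≠ 0), (2 * Real.pi * |(h j : ℝ)|) ^ α) *
        ‖cubeFourierCoeff F h‖)

/-- The expression in mixed derivatives that stands for the `K_{α,γ}` norm at integer `α`:
`max_u γ_u⁻¹ ∫_{[0,1]^{|u|}} |∫_{[0,1]^{s-|u|}} ∂^{ν_u} F| dy_u`. -/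
def korobovDerivNorm {s : ℕ} (α : ℕ) (γ : Finset (Fin s) → ℝ) (F : (Fin s → ℝ) → ℝ) : ℝ :=
  ⨆ u : Finset (Fin s),
    (1 / γ u) * ∫ y in Icc (0 : {j // j ∈ u} → ℝ) 1, |projDeriv α u F y|

/-! ### Constants and right-hand sides -/

/-- `P_k = ∏_{t=1}^k (ξ τ R_t)`. -/
def constP (ξ τ : ℝ) (R : ℕ → ℝ) (k : ℕ) : ℝ := ∏ t ∈ Finset.Icc 1 k, (ξ * τ * R t)

/-- `S_ℓ = τ ∑_{k=0}^{ℓ-1} P_k`. -/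
def constS (ξ τ : ℝ) (R : ℕ → ℝ) (ℓ : ℕ) : ℝ := τ * ∑ k ∈ Finset.range ℓ, constP ξ τ R k

/-- `C_ℓ = max {‖F‖_∞, P_ℓ / S_ℓ}`, to be used with `F = G^{[ℓ]}`. -/
def constC {s N : ℕ} (ξ τ : ℝ) (R : ℕ → ℝ) (ℓ : ℕ) (F : (Fin s → ℝ) → (Fin N → ℝ)) : ℝ :=
  max (cubeSupNorm F) (constP ξ τ R ℓ / constS ξ τ R ℓ)

/-- `∑_u γ_u⁻¹ ((|u| + k)! ∏_{j ∈ u} b_j)²`. -/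
def podNormSum {s : ℕ} (k : ℕ) (γ : Finset (Fin s) → ℝ) (b : Fin s → ℝ) : ℝ :=
  ∑ u : Finset (Fin s), (1 / γ u) * (((u.card + k)! : ℝ) * ∏ j ∈ u, b j) ^ 2

/-- `∑_u ((2π)^{2α|u|} / γ_u) (∑_{m_u ≤ α_u} (|m_u| + k)! S(α_u,m_u) ∏_{j ∈ u} b_j^{m_j})²`. -/
def spodNormSum {s : ℕ} (k α : ℕ) (γ : Finset (Fin s) → ℝ) (b : Fin s → ℝ) : ℝ :=
  ∑ u : Finset (Fin s), (2 * Real.pi) ^ (2 * α * u.card) / γ u *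
    spodSum k (fun _ : {j // j ∈ u} => α) (fun j => b j) ^ 2

/-- `max_u ((2π)^{α|u|} / γ_u) ∑_{m_u ≤ α_u} (|m_u| + k)! S(α_u,m_u) ∏_{j ∈ u} b_j^{m_j}`. -/
def spodNormMax {s : ℕ} (k α : ℕ) (γ : Finset (Fin s) → ℝ) (b : Fin s → ℝ) : ℝ :=
  ⨆ u : Finset (Fin s), (2 * Real.pi) ^ (α * u.card) / γ u *
    spodSum k (fun _ : {j // j ∈ u} => α) (fun j => b j)

end DNNReg

end

open DNNReg

/-!
All derivative bounds come from a majorant calculus.  A function `f` on the cube is majorized by an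
element `a` of a commutative algebra with derivations `D_j` and an evaluation `ε` if every iterated
partial derivative of `f` is bounded by the evaluation of the corresponding iterated derivation of
`a` (`IsMajorant`).  Majorants are compatible with sums and products, because both sides obey the
Leibniz rule, and with composition (`IsMajorant.comp`), because both sides obey the chain rule.

The condition on `σ` says that `ξ / (1 - τ x)` is a majorant of `σ`, up to the constant term.  Since
Möbius transforms are closed under composition, the layer `ℓ` of a network has the majorant
`P_ℓ X / (1 - S_ℓ X)`, up to a constant (`isMajorant_layer`, `isMajorant_dnn`); here `X` stands for
`∑ β_j x_j` for the non-periodic network and for `∑ β_j (exp (2π x_j) - 1)` for the periodic one,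
the latter because `exp (2π x) - 1` majorizes `sin (2π x)`.  In the first case the algebra is
`ℝ⟦X⟧`; in the second one adjoins variables for the functions `exp (2π x_j)`.  Evaluating the
iterated derivations (`podEval_iterOp`, `spodEval_iterOp`) gives the factorials, and in the second
case the Stirling numbers.

Under the restrictions on `β` and `C`, the derivatives of the Möbius majorant are bounded by those
of `C / (1 - X)` with `b` in place of `β`.  If `F` and `G` have that majorant, then `(G - F)²` has
the majorant `4 C² / (1 - X)²`, whose coefficients account for `(|ν| + 1)!` in place of `|ν|!`.

The bounds on the norms follow, because the cubes of integration have volume one.  For the Fourier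
form of the Korobov norm, the divergence theorem on the cube shows that a partial derivative in
direction `j` multiplies the Fourier coefficient of a smooth periodic function at `h` by `2πi h_j`
(`cubeFourierCoeff_iterOp`).
-/

namespace DNNReg

/-! ### Partial derivatives on the cube -/

section Cube

variable {s : ℕ} {j : Fin s} {F G : (Fin s → ℝ) → ℝ} {y : Fin s → ℝ}

lemma unitCube_eq_pi (s : ℕ) : unitCube s = univ.pi fun _ : Fin s => Icc (0 : ℝ) 1 :=
  (pi_univ_Icc (0 : Fin s → ℝ) 1).symm

lemma uniqueDiffOn_unitCube (s : ℕ) : UniqueDiffOn ℝ (unitCube s) := by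
  rw [unitCube_eq_pi]
  exact UniqueDiffOn.univ_pi fun _ => uniqueDiffOn_Icc_zero_one

lemma apply_mem_Icc_of_mem_unitCube (hy : y ∈ unitCube s) (j : Fin s) : y j ∈ Icc (0 : ℝ) 1 :=
  ⟨hy.1 j, hy.2 j⟩

lemma update_mem_unitCube (hy : y ∈ unitCube s) (j : Fin s) {t : ℝ} (ht : t ∈ Icc (0 : ℝ) 1) :
    Function.update y j t ∈ unitCube s := by
  rw [unitCube_eq_pi, mem_univ_pi] at *
  intro i
  by_cases h : i = j
  · subst h; simpa using ht
  · simpa [h] using hy i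

lemma partialDeriv_congr (j : Fin s) (h : EqOn F G (unitCube s)) :
    EqOn (partialDeriv j F) (partialDeriv j G) (unitCube s) := fun y hy =>
  derivWithin_congr (fun _ ht => h (update_mem_unitCube hy j ht)) (by simpa using h hy)

lemma hasDerivWithinAt_comp_update (hF : DifferentiableOn ℝ F (unitCube s))
    (hy : y ∈ unitCube s) (j : Fin s) :
    HasDerivWithinAt (fun t => F (Function.update y j t))
      (fderivWithin ℝ F (unitCube s) y (Pi.single j 1)) (Icc 0 1) (y j) := by
  have h1 : HasDerivWithinAt (Function.update y j) (Pi.single j 1) (Icc 0 1) (y j) :=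
    (hasDerivAt_update y j (y j)).hasDerivWithinAt
  have h2 : HasFDerivWithinAt F (fderivWithin ℝ F (unitCube s) y) (unitCube s)
      (Function.update y j (y j)) := by
    simpa using (hF y hy).hasFDerivWithinAt
  exact h2.comp_hasDerivWithinAt (y j) h1 fun t ht => update_mem_unitCube hy j ht

lemma hasDerivWithinAt_partialDeriv (hF : DifferentiableOn ℝ F (unitCube s))
    (hy : y ∈ unitCube s) (j : Fin s) :
    HasDerivWithinAt (fun t => F (Function.update y j t)) (partialDeriv j F y)
      (Icc 0 1) (y j) :=
  (hasDerivWithinAt_comp_update hF hy j).differentiableWithinAt.hasDerivWithinAt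

lemma partialDeriv_eq_of_hasDerivWithinAt (hy : y ∈ unitCube s) {c : ℝ}
    (h : HasDerivWithinAt (fun t => F (Function.update y j t)) c (Icc 0 1) (y j)) :
    partialDeriv j F y = c :=
  h.derivWithin (uniqueDiffOn_Icc_zero_one _ (apply_mem_Icc_of_mem_unitCube hy j))

lemma partialDeriv_eq_fderivWithin (hF : DifferentiableOn ℝ F (unitCube s))
    (hy : y ∈ unitCube s) (j : Fin s) :
    partialDeriv j F y = fderivWithin ℝ F (unitCube s) y (Pi.single j 1) :=
  partialDeriv_eq_of_hasDerivWithinAt hy (hasDerivWithinAt_comp_update hF hy j)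

lemma ContDiffOn.partialDeriv (hF : ContDiffOn ℝ ∞ F (unitCube s)) (j : Fin s) :
    ContDiffOn ℝ ∞ (partialDeriv j F) (unitCube s) := by
  have h : ContDiffOn ℝ ∞ (fun y => fderivWithin ℝ F (unitCube s) y (Pi.single j 1))
      (unitCube s) :=
    (hF.fderivWithin (uniqueDiffOn_unitCube s) (by simp)).clm_apply contDiffOn_const
  exact h.congr fun y hy => partialDeriv_eq_fderivWithin (hF.differentiableOn (by simp)) hy j

lemma partialDeriv_const (j : Fin s) (c : ℝ) :
    EqOn (partialDeriv j fun _ => c) (fun _ => 0) (unitCube s) := fun _ hy =>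
  partialDeriv_eq_of_hasDerivWithinAt hy (hasDerivWithinAt_const _ _ _)

lemma partialDeriv_mul (hF : DifferentiableOn ℝ F (unitCube s))
    (hG : DifferentiableOn ℝ G (unitCube s)) (j : Fin s) :
    EqOn (partialDeriv j fun y => F y * G y)
      (fun y => partialDeriv j F y * G y + F y * partialDeriv j G y) (unitCube s) := fun y hy =>
  partialDeriv_eq_of_hasDerivWithinAt hy <| by
    have h := (hasDerivWithinAt_partialDeriv hF hy j).mul (hasDerivWithinAt_partialDeriv hG hy j)
    simp only [Function.update_eq_self] at h
    exact h

lemma partialDeriv_add (hF : DifferentiableOn ℝ F (unitCube s))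
    (hG : DifferentiableOn ℝ G (unitCube s)) (j : Fin s) :
    EqOn (partialDeriv j fun y => F y + G y)
      (fun y => partialDeriv j F y + partialDeriv j G y) (unitCube s) := fun _ hy =>
  partialDeriv_eq_of_hasDerivWithinAt hy
    ((hasDerivWithinAt_partialDeriv hF hy j).add (hasDerivWithinAt_partialDeriv hG hy j))

lemma partialDeriv_sum {ι : Type*} [Fintype ι] {f : ι → (Fin s → ℝ) → ℝ} (w : ι → ℝ) (c : ℝ)
    (hf : ∀ q, DifferentiableOn ℝ (f q) (unitCube s)) (j : Fin s) :
    EqOn (partialDeriv j fun y => (∑ q, w q * f q y) + c)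
      (fun y => ∑ q, w q * partialDeriv j (f q) y) (unitCube s) := fun _ hy =>
  partialDeriv_eq_of_hasDerivWithinAt hy <|
    (HasDerivWithinAt.fun_sum fun q _ =>
      (hasDerivWithinAt_partialDeriv (hf q) hy j).const_mul (w q)).add_const c

lemma partialDeriv_comp {κ κ' : ℝ → ℝ} (hκ : ∀ x, HasDerivAt κ (κ' x) x)
    (hF : DifferentiableOn ℝ F (unitCube s)) (j : Fin s) :
    EqOn (partialDeriv j fun y => κ (F y)) (fun y => κ' (F y) * partialDeriv j F y)
      (unitCube s) := fun y hy =>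
  partialDeriv_eq_of_hasDerivWithinAt hy <| by
    have h := (hκ (F (Function.update y j (y j)))).comp_hasDerivWithinAt (y j)
      (hasDerivWithinAt_partialDeriv hF hy j)
    simp only [Function.update_eq_self] at h
    exact h

end Cube

/-! ### Majorants in a differential algebra -/

section Majorant

variable {s : ℕ} {𝓐 : Type*} [CommRing 𝓐] [Algebra ℝ 𝓐]
  (D : Fin s → Derivation ℝ 𝓐 𝓐) (ε : 𝓐 →ₐ[ℝ] ℝ)

/-- `a` majorizes `f` on the unit cube along the word `l` of directions: for every subword
`j₁ … jₖ` of `l`, the derivative `∂_{jₖ} ⋯ ∂_{j₁} f` is bounded on the cube by the real number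
`ε (D_{jₖ} ⋯ D_{j₁} a)`.  Here `a` is an element of an algebra with derivations `D j` and an
evaluation `ε`, in place of a function to be differentiated at one point. -/
def IsMajorant : List (Fin s) → ((Fin s → ℝ) → ℝ) → 𝓐 → Prop
  | [], f, a => ∀ y ∈ unitCube s, |f y| ≤ ε a
  | j :: l, f, a => IsMajorant l f a ∧ IsMajorant l (partialDeriv j f) (D j a)

variable {D ε}

lemma isMajorant_congr {l : List (Fin s)} {f g : (Fin s → ℝ) → ℝ} {a : 𝓐}
    (h : EqOn f g (unitCube s)) : IsMajorant D ε l f a ↔ IsMajorant D ε l g a := by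
  induction l generalizing f g a with
  | nil => exact forall₂_congr fun y hy => by rw [h hy]
  | cons j l ih => exact and_congr (ih h) (ih (partialDeriv_congr j h))

lemma IsMajorant.add {l : List (Fin s)} {f g : (Fin s → ℝ) → ℝ} {a b : 𝓐}
    (hf : ContDiffOn ℝ ∞ f (unitCube s)) (hg : ContDiffOn ℝ ∞ g (unitCube s))
    (hfa : IsMajorant D ε l f a) (hgb : IsMajorant D ε l g b) :
    IsMajorant D ε l (fun y => f y + g y) (a + b) := by
  induction l generalizing f g a b with
  | nil =>
    intro y hy
    rw [map_add]
    exact (abs_add_le _ _).trans (add_le_add (hfa y hy) (hgb y hy))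
  | cons j l ih =>
    refine ⟨ih hf hg hfa.1 hgb.1, ?_⟩
    rw [isMajorant_congr (partialDeriv_add (hf.differentiableOn (by simp))
      (hg.differentiableOn (by simp)) j), map_add]
    exact ih (hf.partialDeriv j) (hg.partialDeriv j) hfa.2 hgb.2

lemma IsMajorant.mul {l : List (Fin s)} {f g : (Fin s → ℝ) → ℝ} {a b : 𝓐}
    (hf : ContDiffOn ℝ ∞ f (unitCube s)) (hg : ContDiffOn ℝ ∞ g (unitCube s))
    (hfa : IsMajorant D ε l f a) (hgb : IsMajorant D ε l g b) :
    IsMajorant D ε l (fun y => f y * g y) (a * b) := by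
  induction l generalizing f g a b with
  | nil =>
    intro y hy
    rw [map_mul, abs_mul]
    exact mul_le_mul (hfa y hy) (hgb y hy) (abs_nonneg _) ((abs_nonneg _).trans (hfa y hy))
  | cons j l ih =>
    refine ⟨ih hf hg hfa.1 hgb.1, ?_⟩
    have hD : D j (a * b) = D j a * b + a * D j b := by
      rw [Derivation.leibniz, smul_eq_mul, smul_eq_mul]; ring
    rw [isMajorant_congr (partialDeriv_mul (hf.differentiableOn (by simp))
      (hg.differentiableOn (by simp)) j), hD]
    exact ((ih (hf.partialDeriv j) hg hfa.2 hgb.1)).add ((hf.partialDeriv j).mul hg)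
      (hf.mul (hg.partialDeriv j)) (ih hf (hg.partialDeriv j) hfa.1 hgb.2)

/-- The hypothesis `h0` says that the evaluations of `a` and its derivatives along `l` are
nonnegative; it is implied by `hfa` unless `ι` is empty. -/
lemma IsMajorant.sum {ι : Type*} [Fintype ι] {l : List (Fin s)} {f : ι → (Fin s → ℝ) → ℝ}
    {a : 𝓐} {w : ι → ℝ} {r : ℝ} (hw : ∑ q, |w q| ≤ r)
    (hf : ∀ q, ContDiffOn ℝ ∞ (f q) (unitCube s)) (h0 : IsMajorant D ε l (fun _ => 0) a)
    (hfa : ∀ q, IsMajorant D ε l (f q) a) :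
    IsMajorant D ε l (fun y => ∑ q, w q * f q y) (r • a) := by
  induction l generalizing f a with
  | nil =>
    intro y hy
    have ha : 0 ≤ ε a := by simpa using h0 y hy
    calc |∑ q, w q * f q y| ≤ ∑ q, |w q| * ε a :=
          (Finset.abs_sum_le_sum_abs _ _).trans (Finset.sum_le_sum fun q _ => by
            rw [abs_mul]; exact mul_le_mul_of_nonneg_left (hfa q y hy) (abs_nonneg _))
      _ ≤ r * ε a := by
          rw [← Finset.sum_mul]; exact mul_le_mul_of_nonneg_right hw ha
      _ = ε (r • a) := by rw [map_smul, smul_eq_mul]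
  | cons j l ih =>
    refine ⟨ih hf h0.1 fun q => (hfa q).1, ?_⟩
    have h := partialDeriv_sum w 0 (fun q => (hf q).differentiableOn (by simp)) j
    simp only [add_zero] at h
    rw [isMajorant_congr h, Derivation.map_smul]
    exact ih (fun q => (hf q).partialDeriv j) ((isMajorant_congr (partialDeriv_const j 0)).1 h0.2)
      fun q => (hfa q).2

lemma IsMajorant.neg {l : List (Fin s)} {f : (Fin s → ℝ) → ℝ} {a : 𝓐}
    (hf : ContDiffOn ℝ ∞ f (unitCube s)) (h : IsMajorant D ε l f a) :
    IsMajorant D ε l (fun y => -f y) a := by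
  induction l generalizing f a with
  | nil => exact fun y hy => (abs_neg (f y)).trans_le (h y hy)
  | cons j l ih =>
    refine ⟨ih hf h.1, ?_⟩
    have h' := partialDeriv_sum (fun _ : Unit => (-1 : ℝ)) 0
      (fun _ => hf.differentiableOn (by simp)) j
    simp only [Finset.univ_unique, Finset.sum_singleton, neg_mul, one_mul, add_zero] at h'
    rw [isMajorant_congr h']
    exact ih (hf.partialDeriv j) h.2

/-- The chain rule for majorants.  The elements `H k` play the role of `h^{(k)}(g)` with `h` a
majorant of the outer function `κ 0` and `κ k` its `k`-th derivative.  Only the derivatives of `f`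
and of `g` enter, so that no bound on `f` itself is needed. -/
lemma IsMajorant.comp {f : (Fin s → ℝ) → ℝ} {g : 𝓐} {κ : ℕ → ℝ → ℝ} {H : ℕ → 𝓐}
    (hκ : ∀ k x, HasDerivAt (κ k) (κ (k + 1) x) x) (hκs : ∀ k, ContDiff ℝ ∞ (κ k))
    (hκH : ∀ k, 1 ≤ k → ∀ x, |κ k x| ≤ ε (H k))
    (hH : ∀ k j, D j (H k) = H (k + 1) * D j g)
    (hf : ContDiffOn ℝ ∞ f (unitCube s))
    (hfg : ∀ j l, IsMajorant D ε l (partialDeriv j f) (D j g)) (j : Fin s) (l : List (Fin s)) :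
    IsMajorant D ε l (partialDeriv j fun y => κ 0 (f y)) (D j (H 0)) := by
  have hc : ∀ k, ContDiffOn ℝ ∞ (fun y => κ k (f y)) (unitCube s) := fun k =>
    (hκs k).comp_contDiffOn hf
  have hstep : ∀ k j l, IsMajorant D ε l (fun y => κ (k + 1) (f y)) (H (k + 1)) →
      IsMajorant D ε l (partialDeriv j fun y => κ k (f y)) (D j (H k)) := by
    intro k j l h
    rw [isMajorant_congr (partialDeriv_comp (hκ k) (hf.differentiableOn (by simp)) j), hH]
    exact h.mul (hc _) (hf.partialDeriv j) (hfg j l)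
  have hmain : ∀ l k, IsMajorant D ε l (fun y => κ (k + 1) (f y)) (H (k + 1)) := by
    intro l
    induction l with
    | nil => exact fun k y _ => hκH (k + 1) (Nat.le_add_left _ _) _
    | cons j l ih => exact fun k => ⟨ih k, hstep (k + 1) j l (ih (k + 1))⟩
  exact hstep 0 j l (hmain l 0)

/-! ### Iterated derivatives along words -/

/-- Apply the operators `D j` successively for `j` in the word, its head first. -/
def iterOp {ι α : Type*} (D : ι → α → α) : List ι → α → α
  | [], a => a
  | j :: l, a => iterOp D l (D j a)

lemma iterOp_append {ι α : Type*} (D : ι → α → α) (l l' : List ι) (a : α) :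
    iterOp D (l ++ l') a = iterOp D l' (iterOp D l a) := by
  induction l generalizing a with
  | nil => rfl
  | cons j l ih => exact ih _

lemma iterOp_replicate {ι α : Type*} (D : ι → α → α) (n : ℕ) (j : ι) (a : α) :
    iterOp D (List.replicate n j) a = (D j)^[n] a := by
  induction n generalizing a with
  | zero => rfl
  | succ n ih => exact ih _

lemma isMajorant_iff {l : List (Fin s)} {f : (Fin s → ℝ) → ℝ} {a : 𝓐} :
    IsMajorant D ε l f a ↔ ∀ l', l'.Sublist l → ∀ y ∈ unitCube s,
      |iterOp partialDeriv l' f y| ≤ ε (iterOp (fun j => D j) l' a) := by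
  induction l generalizing f a with
  | nil => simp [IsMajorant, iterOp]
  | cons j l ih =>
    rw [IsMajorant, ih, ih]
    constructor
    · rintro ⟨h1, h2⟩ l' hl'
      rcases List.sublist_cons_iff.1 hl' with h | ⟨r, rfl, h⟩
      · exact h1 l' h
      · exact h2 r h
    · exact fun h => ⟨fun l' hl' => h l' (hl'.cons j), fun l' hl' => h (j :: l') (hl'.cons_cons j)⟩

lemma IsMajorant.bound {l : List (Fin s)} {f : (Fin s → ℝ) → ℝ} {a : 𝓐}
    (h : IsMajorant D ε l f a) {y : Fin s → ℝ} (hy : y ∈ unitCube s) :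
    |iterOp partialDeriv l f y| ≤ ε (iterOp (fun j => D j) l a) :=
  isMajorant_iff.1 h l (List.Sublist.refl l) y hy

/-- The word in which each letter `j` occurs `ν j` times, in the order in which `mixedDeriv`
differentiates. -/
def word (ν : Fin s → ℕ) : List (Fin s) :=
  (List.finRange s).reverse.flatMap fun j => List.replicate (ν j) j

lemma mixedDeriv_eq_iterOp (ν : Fin s → ℕ) (F : (Fin s → ℝ) → ℝ) :
    mixedDeriv ν F = iterOp partialDeriv (word ν) F := by
  have h : ∀ (js : List (Fin s)) (F : (Fin s → ℝ) → ℝ),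
      js.foldl (fun g j => (partialDeriv j)^[ν j] g) F
        = iterOp partialDeriv (js.flatMap fun j => List.replicate (ν j) j) F := by
    intro js
    induction js with
    | nil => exact fun _ => rfl
    | cons j js ih =>
      intro F
      rw [List.foldl_cons, ih, List.flatMap_cons, iterOp_append, iterOp_replicate]
  rw [mixedDeriv, word, ← h, List.foldl_reverse]

lemma count_word (ν : Fin s → ℕ) (j : Fin s) : (word ν).count j = ν j := by
  have h : ∀ js : List (Fin s), js.Nodup →
      (js.flatMap fun j => List.replicate (ν j) j).count j = if j ∈ js then ν j else 0 := by
    intro js hjs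
    induction js with
    | nil => simp
    | cons i js ih =>
      rw [List.nodup_cons] at hjs
      rw [List.flatMap_cons, List.count_append, ih hjs.2, List.count_replicate]
      by_cases hij : i = j
      · subst hij; simp [hjs.1]
      · simp [hij, Ne.symm hij]
  rw [word, h _ (List.nodup_reverse.2 (List.nodup_finRange s))]
  simp

/-- Every subword of a sorted word is again a sorted word; hence the bounds on all mixed
derivatives suffice for `IsMajorant`, with no need to interchange derivatives. -/
lemma exists_word_of_sublist {l : List (Fin s)} {ν : Fin s → ℕ} (h : l.Sublist (word ν)) :
    ∃ μ : Fin s → ℕ, l = word μ := by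
  have key : ∀ (js : List (Fin s)), js.Nodup → ∀ l : List (Fin s),
      l.Sublist (js.flatMap fun j => List.replicate (ν j) j) →
      ∃ μ : Fin s → ℕ, l = js.flatMap fun j => List.replicate (μ j) j := by
    intro js hjs
    induction js with
    | nil => exact fun l hl => ⟨0, by simpa using hl⟩
    | cons i js ih =>
      intro l hl
      rw [List.nodup_cons] at hjs
      rw [List.flatMap_cons, List.sublist_append_iff] at hl
      obtain ⟨l₁, l₂, rfl, h₁, h₂⟩ := hl
      obtain ⟨n, -, rfl⟩ := List.sublist_replicate_iff.1 h₁
      obtain ⟨μ, rfl⟩ := ih hjs.2 l₂ h₂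
      refine ⟨Function.update μ i n, ?_⟩
      rw [List.flatMap_cons, Function.update_self]
      congr 1
      refine List.flatMap_congr fun j hj => ?_
      rw [Function.update_of_ne]
      rintro rfl
      exact hjs.1 hj
  exact key _ (List.nodup_reverse.2 (List.nodup_finRange s)) l h

lemma isMajorant_word {f : (Fin s → ℝ) → ℝ} {a : 𝓐}
    (h : ∀ μ : Fin s → ℕ, ∀ y ∈ unitCube s,
      |mixedDeriv μ f y| ≤ ε (iterOp (fun j => D j) (word μ) a)) (ν : Fin s → ℕ) :
    IsMajorant D ε (word ν) f a := by
  refine isMajorant_iff.2 fun l hl y hy => ?_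
  obtain ⟨μ, rfl⟩ := exists_word_of_sublist hl
  rw [← mixedDeriv_eq_iterOp]
  exact h μ y hy

end Majorant

/-! ### Möbius majorants of the layers -/

section Series

open PowerSeries

/-- The geometric series `1 / (1 - S X)`. -/
noncomputable def geomSeries (S : ℝ) : ℝ⟦X⟧ := PowerSeries.mk fun n => S ^ n

/-- The series `P X / (1 - S X)`, the majorant of a layer up to an additive constant. -/
noncomputable def layerSeries (P S : ℝ) : ℝ⟦X⟧ := C P * X * geomSeries S

lemma geomSeries_mul (S : ℝ) : geomSeries S * (1 - C S * X) = 1 := by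
  ext n
  rw [mul_sub, mul_one, ← mul_assoc, mul_comm _ (C S), mul_assoc, map_sub, coeff_C_mul]
  cases n with
  | zero => simp [geomSeries]
  | succ n => simp [geomSeries, coeff_succ_mul_X, coeff_one, pow_succ']

lemma derivative_geomSeries (S : ℝ) :
    derivative ℝ (geomSeries S) = C S * geomSeries S ^ 2 := by
  have h := geomSeries_mul S
  have h' : derivative ℝ (geomSeries S * (1 - C S * X)) = 0 := by
    rw [h, Derivation.map_one_eq_zero]
  rw [Derivation.leibniz] at h'
  simp only [map_sub, Derivation.leibniz, derivative_X, derivative_C, smul_eq_mul,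
    Derivation.map_one_eq_zero] at h'
  linear_combination geomSeries S * h' - (derivative ℝ (geomSeries S)) * h

lemma derivative_layerSeries (P S : ℝ) :
    derivative ℝ (layerSeries P S) = C P * geomSeries S ^ 2 := by
  simp only [layerSeries, Derivation.leibniz, derivative_X, derivative_C, smul_eq_mul,
    derivative_geomSeries]
  linear_combination -C P * geomSeries S * geomSeries_mul S

lemma coeff_layerSeries_succ (P S : ℝ) (n : ℕ) :
    coeff (n + 1) (layerSeries P S) = P * S ^ n := by
  rw [layerSeries, mul_assoc, coeff_C_mul, mul_comm X, coeff_succ_mul_X, geomSeries, coeff_mk]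

/-- The series `h^{(k)}(g)` for `h(x) = ξ / (1 - τ x)` and `g = P X / (1 - S X)`, where
`S' = S + τ P`. -/
noncomputable def activationSeries (ξ τ S S' : ℝ) (k : ℕ) : ℝ⟦X⟧ :=
  C (ξ * τ ^ k * (k ! : ℝ)) * ((1 - C S * X) * geomSeries S') ^ (k + 1)

lemma constantCoeff_activationSeries (ξ τ S S' : ℝ) (k : ℕ) :
    constantCoeff (activationSeries ξ τ S S' k) = ξ * τ ^ k * (k ! : ℝ) := by
  simp [activationSeries, geomSeries]

lemma derivative_mobius (S S' : ℝ) :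
    derivative ℝ ((1 - C S * X) * geomSeries S') = C (S' - S) * geomSeries S' ^ 2 := by
  simp only [map_sub, Derivation.leibniz, derivative_X, derivative_C, smul_eq_mul,
    Derivation.map_one_eq_zero, derivative_geomSeries]
  linear_combination C S * geomSeries S' * geomSeries_mul S'

lemma derivative_activationSeries (ξ τ P S : ℝ) (k : ℕ) :
    derivative ℝ (activationSeries ξ τ S (S + τ * P) k) =
      activationSeries ξ τ S (S + τ * P) (k + 1) * derivative ℝ (layerSeries P S) := by
  rw [activationSeries, activationSeries, derivative_layerSeries, Derivation.leibniz,
    Derivation.leibniz_pow, derivative_mobius, derivative_C, Nat.factorial_succ]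
  simp only [smul_eq_mul, nsmul_eq_mul, add_tsub_cancel_left, map_mul, map_add, map_pow,
    Nat.add_sub_cancel, map_natCast, Nat.cast_mul, Nat.cast_add, Nat.cast_one, map_one]
  have h := geomSeries_mul S
  set q := geomSeries S
  set q' := geomSeries (S + τ * P)
  have h2 : ((1 - C S * X) * q) ^ 2 = 1 := by rw [mul_comm, h, one_pow]
  linear_combination -(C ξ * C τ ^ k * (k ! : ℝ⟦X⟧) * ((k : ℝ⟦X⟧) + 1) *
    ((1 - C S * X) * q') ^ k * (C τ * C P) * q' ^ 2) * h2

lemma derivative_layerSeries_next (ξ τ P S r : ℝ) :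
    derivative ℝ (layerSeries (ξ * τ * r * P) (S + τ * P)) =
      r • derivative ℝ (activationSeries ξ τ S (S + τ * P) 0) := by
  rw [derivative_layerSeries, activationSeries, Derivation.leibniz, pow_one, derivative_mobius,
    derivative_C, PowerSeries.smul_eq_C_mul]
  simp only [smul_eq_mul, map_mul, add_sub_cancel_left]
  simp
  ring

end Series

section Layers

open PowerSeries (constantCoeff derivative)

variable {s : ℕ} {𝓐 : Type*} [CommRing 𝓐] [Algebra ℝ 𝓐]
  {D : Fin s → Derivation ℝ 𝓐 𝓐} {ε : 𝓐 →ₐ[ℝ] ℝ} {ι : PowerSeries ℝ →ₐ[ℝ] 𝓐} {c : Fin s → 𝓐}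

lemma hasDerivAt_iteratedDeriv {σ : ℝ → ℝ} (hσ : ContDiff ℝ ∞ σ) (k : ℕ) (x : ℝ) :
    HasDerivAt (iteratedDeriv k σ) (iteratedDeriv (k + 1) σ x) x := by
  rw [iteratedDeriv_succ]
  exact ((hσ.differentiable_iteratedDeriv k (by exact_mod_cast ENat.natCast_lt_top k)) x).hasDerivAt

lemma contDiff_iteratedDeriv {σ : ℝ → ℝ} (hσ : ContDiff ℝ ∞ σ) (k : ℕ) :
    ContDiff ℝ ∞ (iteratedDeriv k σ) := by
  rw [contDiff_infty]
  intro n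
  rw [iteratedDeriv_eq_iterate]
  exact (contDiff_infty.1 hσ (n + k)).iterate_deriv' n k

/-- Composition with the activation function turns the majorant `P X / (1 - S X)` into
`ξ / (1 - τ g)`, again a Möbius transform. -/
lemma isMajorant_activation (hD : ∀ j A, D j (ι A) = c j * ι (derivative ℝ A))
    (hε : ∀ A, ε (ι A) = constantCoeff A) {ξ τ P S : ℝ} {σ : ℝ → ℝ} (hσ : ContDiff ℝ ∞ σ)
    (hσA : ∀ n : ℕ, 1 ≤ n → ∀ x : ℝ, |iteratedDeriv n σ x| ≤ ξ * τ ^ n * (n ! : ℝ))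
    {f : (Fin s → ℝ) → ℝ} (hf : ContDiffOn ℝ ∞ f (unitCube s))
    (hfg : ∀ j l, IsMajorant D ε l (partialDeriv j f) (D j (ι (layerSeries P S))))
    (j : Fin s) (l : List (Fin s)) :
    IsMajorant D ε l (partialDeriv j fun y => σ (f y))
      (D j (ι (activationSeries ξ τ S (S + τ * P) 0))) := by
  have := IsMajorant.comp (κ := fun k => iteratedDeriv k σ)
    (H := fun k => ι (activationSeries ξ τ S (S + τ * P) k))
    (hasDerivAt_iteratedDeriv hσ) (contDiff_iteratedDeriv hσ)
    (fun k hk x => by rw [hε, constantCoeff_activationSeries]; exact hσA k hk x)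
    (fun k j => by rw [hD, hD, derivative_activationSeries, map_mul]; ring) hf hfg j l
  simpa using this

/-- One layer of the network takes `P X / (1 - S X)` to `ξ τ r P X / (1 - (S + τ P) X)`. -/
lemma isMajorant_layer (hD : ∀ j A, D j (ι A) = c j * ι (derivative ℝ A))
    (hε : ∀ A, ε (ι A) = constantCoeff A) {ξ τ P S r : ℝ} (hξ : 0 < ξ) (hτ : 0 < τ)
    {σ : ℝ → ℝ} (hσ : ContDiff ℝ ∞ σ)
    (hσA : ∀ n : ℕ, 1 ≤ n → ∀ x : ℝ, |iteratedDeriv n σ x| ≤ ξ * τ ^ n * (n ! : ℝ))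
    {κ : Type*} [Fintype κ] {f : κ → (Fin s → ℝ) → ℝ} {w : κ → ℝ} (v : ℝ)
    (hw : ∑ q, |w q| ≤ r) (hf : ∀ q, ContDiffOn ℝ ∞ (f q) (unitCube s))
    (h0 : ∀ j l, IsMajorant D ε l (fun _ => 0) (D j (ι (layerSeries P S))))
    (hfg : ∀ q j l, IsMajorant D ε l (partialDeriv j (f q)) (D j (ι (layerSeries P S))))
    (j : Fin s) (l : List (Fin s)) :
    IsMajorant D ε l (partialDeriv j fun y => (∑ q, w q * σ (f q y)) + v)
      (D j (ι (layerSeries (ξ * τ * r * P) (S + τ * P)))) := by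
  have hc : ∀ q, ContDiffOn ℝ ∞ (fun y => σ (f q y)) (unitCube s) := fun q =>
    hσ.comp_contDiffOn (hf q)
  have h0' : IsMajorant D ε l (fun _ => 0)
      (D j (ι (activationSeries ξ τ S (S + τ * P) 0))) := by
    -- the zero function is `0 ∘ 0`, with the zero activation
    have := isMajorant_activation (σ := fun _ => 0) (f := fun _ => 0) hD hε (ξ := ξ) (τ := τ)
      contDiff_const (fun n hn x => by
        rw [iteratedDeriv_const, if_neg (by omega), abs_zero]; positivity) contDiffOn_const
      (fun j l => (isMajorant_congr (partialDeriv_const j 0)).2 (h0 j l)) j l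
    exact (isMajorant_congr (partialDeriv_const j 0)).1 this
  rw [isMajorant_congr (partialDeriv_sum w v (fun q => (hc q).differentiableOn (by simp)) j), hD,
    derivative_layerSeries_next, map_smul, mul_smul_comm, ← hD]
  exact IsMajorant.sum hw (fun q => (hc q).partialDeriv j) h0'
    fun q => isMajorant_activation hD hε hσ hσA (hf q) (hfg q) j l

lemma constP_succ (ξ τ : ℝ) (R : ℕ → ℝ) (k : ℕ) :
    constP ξ τ R (k + 1) = ξ * τ * R (k + 1) * constP ξ τ R k := by
  rw [constP, Finset.prod_Icc_succ_top (Nat.le_add_left 1 k), mul_comm]; rfl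

lemma constS_succ (ξ τ : ℝ) (R : ℕ → ℝ) (k : ℕ) :
    constS ξ τ R (k + 1) = constS ξ τ R k + τ * constP ξ τ R k := by
  rw [constS, Finset.sum_range_succ, mul_add]; rfl

lemma contDiff_dnn {d : ℕ → ℕ} (θ : NetParams d) {σ : ℝ → ℝ} (hσ : ContDiff ℝ ∞ σ) (ℓ : ℕ) :
    ContDiff ℝ ∞ (dnn θ σ ℓ) := by
  induction ℓ with
  | zero =>
    refine contDiff_pi.2 fun p => ?_
    simp only [dnn, Pi.add_apply, Matrix.mulVec, dotProduct]
    fun_prop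
  | succ ℓ ih =>
    refine contDiff_pi.2 fun p => ?_
    simp only [dnn, Pi.add_apply, Matrix.mulVec, dotProduct]
    refine (ContDiff.sum fun q _ => contDiff_const.mul (hσ.comp ?_)).add contDiff_const
    exact contDiff_pi.1 ih q

/-- The layer `ℓ` has the majorant `P_ℓ X / (1 - S_ℓ X)`, up to an additive constant, whatever
the inner map `x` (the identity or `sin (2π ·)`), as soon as the layer `0` has the majorant `X`. -/
lemma isMajorant_dnn (hD : ∀ j A, D j (ι A) = c j * ι (derivative ℝ A))
    (hε : ∀ A, ε (ι A) = constantCoeff A) {d : ℕ → ℕ} {θ : NetParams d} {σ : ℝ → ℝ}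
    {R : ℕ → ℝ} {ξ τ : ℝ} (hξ : 0 < ξ) (hτ : 0 < τ) (hσ : ContDiff ℝ ∞ σ)
    (hσA : ∀ n : ℕ, 1 ≤ n → ∀ x : ℝ, |iteratedDeriv n σ x| ≤ ξ * τ ^ n * (n ! : ℝ))
    {x : (Fin s → ℝ) → (Fin (d 0) → ℝ)} (hx : ContDiff ℝ ∞ x)
    (h0 : ∀ j l, IsMajorant D ε l (fun _ => 0) (D j (ι PowerSeries.X)))
    (hbase : ∀ p j l, IsMajorant D ε l (partialDeriv j fun y => dnn θ σ 0 (x y) p)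
      (D j (ι PowerSeries.X)))
    (L : ℕ) (hR_pos : ∀ ℓ, 1 ≤ ℓ → ℓ ≤ L → 0 < R ℓ)
    (hR : ∀ ℓ, 1 ≤ ℓ → ℓ ≤ L → ∀ p, ∑ q, |θ.W ℓ p q| ≤ R ℓ) (ℓ : ℕ) (hℓ : ℓ ≤ L) :
    (∀ j l, IsMajorant D ε l (fun _ => 0)
      (D j (ι (layerSeries (constP ξ τ R ℓ) (constS ξ τ R ℓ))))) ∧
    ∀ p j l, IsMajorant D ε l (partialDeriv j fun y => dnn θ σ ℓ (x y) p)
      (D j (ι (layerSeries (constP ξ τ R ℓ) (constS ξ τ R ℓ)))) := by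
  induction ℓ with
  | zero =>
    have hX : layerSeries (constP ξ τ R 0) (constS ξ τ R 0) = PowerSeries.X := by
      have h := geomSeries_mul 0
      simp only [map_zero, zero_mul, sub_zero, mul_one] at h
      simp [layerSeries, constP, constS, h]
    rw [hX]
    exact ⟨h0, hbase⟩
  | succ ℓ ih =>
    obtain ⟨ih0, ih⟩ := ih (by omega)
    have hf : ∀ q, ContDiffOn ℝ ∞ (fun y => dnn θ σ ℓ (x y) q) (unitCube s) := fun q =>
      ((contDiff_pi.1 (contDiff_dnn θ hσ ℓ) q).comp hx).contDiffOn
    rw [constP_succ, constS_succ]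
    constructor
    · intro j l
      have h := isMajorant_layer hD hε hξ hτ hσ hσA (κ := Empty)
        (f := fun q => q.elim) (w := fun q => q.elim) 0 (r := R (ℓ + 1))
        (by simpa using (hR_pos (ℓ + 1) (by omega) hℓ).le) (fun q => q.elim) ih0
        (fun q => q.elim) j l
      refine (isMajorant_congr ?_).1 h
      simpa using partialDeriv_const j (0 : ℝ)
    · intro p j l
      exact isMajorant_layer hD hε hξ hτ hσ hσA (θ.v (ℓ + 1) p)
        (hR (ℓ + 1) (by omega) hℓ p) hf ih0 ih j l

end Layers

/-! ### The differential algebra of the POD bounds -/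

section POD

open PowerSeries (constantCoeff derivative coeff)

variable {s : ℕ}

/-- The derivations `b_j d/dX` of `ℝ⟦X⟧`: partial derivatives of functions of `∑ j, b_j x_j`. -/
noncomputable def podDeriv (b : Fin s → ℝ) (j : Fin s) :
    Derivation ℝ (PowerSeries ℝ) (PowerSeries ℝ) := b j • derivative ℝ

/-- The constant coefficient, as an algebra homomorphism. -/
noncomputable def podEval : PowerSeries ℝ →ₐ[ℝ] ℝ :=
  { constantCoeff (R := ℝ) with
    commutes' := fun r => by simp }

lemma podEval_apply (A : PowerSeries ℝ) : podEval A = constantCoeff A := rfl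

lemma podDeriv_apply (b : Fin s → ℝ) (j : Fin s) (A : PowerSeries ℝ) :
    podDeriv b j A = PowerSeries.C (b j) * derivative ℝ A := by
  rw [podDeriv, Derivation.smul_apply, PowerSeries.smul_eq_C_mul]

lemma length_word (ν : Fin s → ℕ) : (word ν).length = ∑ j, ν j := by
  rw [← Multiset.coe_card, ← Multiset.sum_count_eq_card (s := Finset.univ) (by simp)]
  simp [count_word]

lemma prod_map_word {M : Type*} [CommMonoid M] (f : Fin s → M) (ν : Fin s → ℕ) :
    ((word ν).map f).prod = ∏ j, f j ^ ν j := by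
  rw [Finset.prod_list_map_count]
  simp only [count_word]
  refine Finset.prod_subset (Finset.subset_univ _) fun j _ hj => ?_
  rw [← count_word ν j, List.count_eq_zero_of_not_mem (by simpa using hj), pow_zero]

lemma podEval_iterOp (b : Fin s → ℝ) (ν : Fin s → ℕ) (A : PowerSeries ℝ) :
    podEval (iterOp (fun j => podDeriv b j) (word ν) A) =
      (((∑ j, ν j)! : ℕ) : ℝ) * (∏ j, b j ^ ν j) * coeff (∑ j, ν j) A := by
  have hsmul : ∀ (n : ℕ) (r : ℝ) (A : PowerSeries ℝ),
      (derivative ℝ)^[n] (r • A) = r • (derivative ℝ)^[n] A := by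
    intro n r
    induction n with
    | zero => exact fun _ => rfl
    | succ n ih =>
      intro A
      rw [Function.iterate_succ_apply, Function.iterate_succ_apply, Derivation.map_smul, ih]
  have h : ∀ (l : List (Fin s)) (A : PowerSeries ℝ),
      podEval (iterOp (fun j => podDeriv b j) l A) =
        (l.map b).prod * constantCoeff ((derivative ℝ)^[l.length] A) := by
    intro l
    induction l with
    | nil => intro A; simp [iterOp, podEval_apply]
    | cons j l ih =>
      intro A
      rw [iterOp, ih, podDeriv, Derivation.smul_apply, List.length_cons,
        Function.iterate_succ_apply, hsmul, List.map_cons, List.prod_cons,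
        ← podEval_apply, map_smul, smul_eq_mul, podEval_apply]
      ring
  rw [h, PowerSeries.constantCoeff_iterate_derivative, length_word, prod_map_word]
  ring

end POD

/-! ### The differential algebra of the SPOD bounds -/

section SPOD

open PowerSeries (constantCoeff derivative coeff)

variable {s : ℕ}

/-- A derivation of the coefficient ring acts on power series coefficientwise. -/
noncomputable def coeffDerivation {K : Type*} [CommRing K] [Algebra ℝ K] (δ : Derivation ℝ K K) :
    Derivation ℝ (PowerSeries K) (PowerSeries K) :=
  Derivation.mk'
    { toFun := fun A => PowerSeries.mk fun n => δ (coeff n A)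
      map_add' := fun A B => by ext n; simp
      map_smul' := fun r A => by ext n; simp }
    fun A B => by
      ext n
      simp only [LinearMap.coe_mk, AddHom.coe_mk, smul_eq_mul, map_add, PowerSeries.coeff_mk,
        PowerSeries.coeff_mul, map_sum, Derivation.leibniz, Finset.sum_add_distrib]
      congr 1
      rw [← Finset.Nat.sum_antidiagonal_swap]
      rfl

lemma coeff_coeffDerivation {K : Type*} [CommRing K] [Algebra ℝ K] (δ : Derivation ℝ K K)
    (A : PowerSeries K) (n : ℕ) : coeff n (coeffDerivation δ A) = δ (coeff n A) := by
  simp [coeffDerivation]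

/-- Power series in `X` whose coefficients are polynomials in variables `e_j`, which stand for
the functions `exp (2π x_j)`. -/
abbrev SpodAlgebra (s : ℕ) : Type := PowerSeries (MvPolynomial (Fin s) ℝ)

/-- The derivations `2π (b_j e_j d/dX + e_j ∂/∂e_j)`: partial derivatives of functions of
`X = ∑ j, b_j (exp (2π x_j) - 1)` and of `e_j = exp (2π x_j)`. -/
noncomputable def spodDeriv (b : Fin s → ℝ) (j : Fin s) :
    Derivation ℝ (SpodAlgebra s) (SpodAlgebra s) :=
  (2 * Real.pi) • (PowerSeries.C (MvPolynomial.C (b j) * MvPolynomial.X j) •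
    (derivative (MvPolynomial (Fin s) ℝ)).restrictScalars ℝ +
      coeffDerivation ((MvPolynomial.X j : MvPolynomial (Fin s) ℝ) • MvPolynomial.pderiv j))

/-- Evaluation at `X = 0` and `e_j = 1`. -/
noncomputable def spodEval : SpodAlgebra s →ₐ[ℝ] ℝ :=
  { (MvPolynomial.aeval (R := ℝ) (fun _ : Fin s => (1 : ℝ))).toRingHom.comp
      (constantCoeff (R := MvPolynomial (Fin s) ℝ)) with
    commutes' := fun r => by
      simp [PowerSeries.algebraMap_apply] }

/-- The inclusion of the power series with constant coefficients. -/
noncomputable def spodIncl : PowerSeries ℝ →ₐ[ℝ] SpodAlgebra s :=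
  PowerSeries.mapAlgHom (Algebra.ofId ℝ (MvPolynomial (Fin s) ℝ))

/-- The element `b_j e_j`. -/
noncomputable def spodVar (b : Fin s → ℝ) (j : Fin s) : SpodAlgebra s :=
  PowerSeries.C (MvPolynomial.C (b j) * MvPolynomial.X j)

lemma spodEval_apply (A : SpodAlgebra s) :
    spodEval A = MvPolynomial.aeval (fun _ => (1 : ℝ)) (constantCoeff A) := rfl

lemma coeff_spodIncl (A : PowerSeries ℝ) (n : ℕ) :
    coeff n (spodIncl (s := s) A) = MvPolynomial.C (coeff n A) := by
  exact PowerSeries.coeff_map _ _ _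

lemma spodEval_spodIncl (A : PowerSeries ℝ) :
    spodEval (spodIncl (s := s) A) = constantCoeff A := by
  rw [spodEval_apply, ← PowerSeries.coeff_zero_eq_constantCoeff_apply, coeff_spodIncl]
  simp

lemma spodEval_spodVar (b : Fin s → ℝ) (j : Fin s) : spodEval (spodVar b j) = b j := by
  simp [spodEval_apply, spodVar]

lemma spodDeriv_spodIncl (b : Fin s → ℝ) (j : Fin s) (A : PowerSeries ℝ) :
    spodDeriv b j (spodIncl A) =
      ((2 * Real.pi) • spodVar b j) * spodIncl (derivative ℝ A) := by
  have h1 : coeffDerivation ((MvPolynomial.X j : MvPolynomial (Fin s) ℝ) • MvPolynomial.pderiv j)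
      (spodIncl (s := s) A) = 0 := by
    ext1 n
    rw [coeff_coeffDerivation, coeff_spodIncl]
    simp
  have h2 : derivative (MvPolynomial (Fin s) ℝ) (spodIncl A) = spodIncl (derivative ℝ A) := by
    ext1 n
    rw [PowerSeries.coeff_derivative, coeff_spodIncl, coeff_spodIncl,
      PowerSeries.coeff_derivative]
    simp
  rw [spodDeriv, Derivation.smul_apply, Derivation.add_apply, h1, add_zero,
    Derivation.smul_apply, Derivation.restrictScalars_apply, h2, smul_mul_assoc, smul_eq_mul]
  rfl

lemma spodDeriv_spodVar (b b' : Fin s → ℝ) (i j : Fin s) :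
    spodDeriv b j (spodVar b' i) = if i = j then (2 * Real.pi) • spodVar b' j else 0 := by
  have h2 : derivative (MvPolynomial (Fin s) ℝ) (spodVar b' i) = 0 := PowerSeries.derivative_C
  have h1 : coeffDerivation ((MvPolynomial.X j : MvPolynomial (Fin s) ℝ) • MvPolynomial.pderiv j)
      (spodVar b' i) = if i = j then spodVar b' j else 0 := by
    ext1 n
    rw [coeff_coeffDerivation, spodVar, PowerSeries.coeff_C]
    by_cases hn : n = 0
    · subst hn
      by_cases hij : i = j
      · subst hij
        simp [spodVar, mul_comm]
      · simp [hij, MvPolynomial.pderiv_X_of_ne hij]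
    · by_cases hij : i = j
      · simp [hn, hij, spodVar, PowerSeries.coeff_C]
      · simp [hn, hij]
  rw [spodDeriv, Derivation.smul_apply, Derivation.add_apply, h1,
    Derivation.smul_apply, Derivation.restrictScalars_apply, h2, smul_zero, zero_add]
  split_ifs <;> simp

/-- The recurrence of the Stirling numbers, in the form in which it describes the passage from
`ν` to `ν + e_j` in a sum over `m ≤ ν` with weights `∏ i, S(ν_i, m_i)`. -/
lemma sum_stirling_step {M : Type*} [AddCommGroup M] [Module ℝ M] (T : (Fin s → ℕ) → M)
    (ν : Fin s → ℕ) (j : Fin s) :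
    ∑ m ∈ Finset.Iic (ν + Pi.single j 1 : Fin s → ℕ),
        (∏ i, (Nat.stirlingSecond ((ν + Pi.single j 1 : Fin s → ℕ) i) (m i) : ℝ)) • T m =
      ∑ m ∈ Finset.Iic ν, (∏ i, (Nat.stirlingSecond (ν i) (m i) : ℝ)) •
        ((m j : ℝ) • T m + T (m + Pi.single j 1)) := by
  set μ := ν + Pi.single j 1 with hμ
  have hsplit : ∀ a m : Fin s → ℕ, ∏ i, (Nat.stirlingSecond (a i) (m i) : ℝ) =
      (Nat.stirlingSecond (a j) (m j) : ℝ) *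
        ∏ i ∈ Finset.univ.erase j, (Nat.stirlingSecond (a i) (m i) : ℝ) := fun a m =>
    (Finset.mul_prod_erase _ _ (Finset.mem_univ j)).symm
  have hμj : μ j = ν j + 1 := by simp [hμ]
  have hμi : ∀ i, i ≠ j → μ i = ν i := fun i hi => by simp [hμ, hi]
  have hle : ν ≤ μ := le_self_add
  -- terms with `m ≤ μ`, not `m ≤ ν`, carry a vanishing Stirling number
  have h1 : ∑ m ∈ Finset.Iic ν, (∏ i, (Nat.stirlingSecond (ν i) (m i) : ℝ)) • ((m j : ℝ) • T m) =
      ∑ m ∈ Finset.Iic μ, (∏ i, (Nat.stirlingSecond (ν i) (m i) : ℝ)) • ((m j : ℝ) • T m) := by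
    refine Finset.sum_subset (Finset.Iic_subset_Iic.2 hle) fun m _ hm => ?_
    rw [Finset.mem_Iic, Pi.le_def, not_forall] at hm
    obtain ⟨i, hi⟩ := hm
    rw [Finset.prod_eq_zero (Finset.mem_univ i), zero_smul]
    rw [Nat.stirlingSecond_eq_zero_of_lt (not_le.1 hi), Nat.cast_zero]
  have h2 : ∑ m ∈ Finset.Iic ν, (∏ i, (Nat.stirlingSecond (ν i) (m i) : ℝ)) •
        T (m + Pi.single j 1) =
      ∑ m ∈ Finset.Iic μ, if m j ≠ 0 then
        ((Nat.stirlingSecond (ν j) (m j - 1) : ℝ) *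
          ∏ i ∈ Finset.univ.erase j, (Nat.stirlingSecond (ν i) (m i) : ℝ)) • T m else 0 := by
    rw [← Finset.sum_filter]
    refine Finset.sum_bij' (fun m _ => m + Pi.single j 1) (fun m _ => m - Pi.single j 1)
      (fun m hm => ?_) (fun m hm => ?_) (fun m _ => ?_) (fun m hm => ?_) fun m _ => ?_
    · rw [Finset.mem_Iic] at hm
      rw [Finset.mem_filter, Finset.mem_Iic, hμ]
      exact ⟨by gcongr, by simp⟩
    · rw [Finset.mem_filter, Finset.mem_Iic, hμ] at hm
      rw [Finset.mem_Iic]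
      exact tsub_le_iff_right.2 hm.1
    · simp
    · rw [Finset.mem_filter] at hm
      refine tsub_add_cancel_of_le ?_
      intro i
      by_cases hi : i = j
      · subst hi; simpa using Nat.one_le_iff_ne_zero.2 hm.2
      · simp [hi]
    · rw [hsplit ν m]
      congr 2
      · simp
      · refine Finset.prod_congr rfl fun i hi => ?_
        simp [Finset.ne_of_mem_erase hi]
  simp only [smul_add, Finset.sum_add_distrib]
  rw [h1, h2, ← Finset.sum_add_distrib]
  refine Finset.sum_congr rfl fun m _ => ?_
  have hprod : ∏ i ∈ Finset.univ.erase j, (Nat.stirlingSecond (μ i) (m i) : ℝ) =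
      ∏ i ∈ Finset.univ.erase j, (Nat.stirlingSecond (ν i) (m i) : ℝ) :=
    Finset.prod_congr rfl fun i hi => by rw [hμi i (Finset.ne_of_mem_erase hi)]
  rw [hsplit μ, hsplit ν, hprod, hμj]
  by_cases h : m j = 0
  · simp [h]
  · rw [if_pos h, Nat.stirlingSecond_succ_left _ _ h, smul_smul, ← add_smul]
    congr 1
    push_cast
    ring

/-- The mixed derivative of order `ν` at `0` of `A (∑ j, b_j (exp (2π x_j) - 1))`. -/
lemma spodEval_iterOp (b : Fin s → ℝ) (ν : Fin s → ℕ) (A : PowerSeries ℝ) :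
    spodEval (iterOp (fun j => spodDeriv b j) (word ν) (spodIncl A)) =
      (2 * Real.pi) ^ (∑ j, ν j) * ∑ m ∈ Finset.Iic ν,
        (∏ j, (Nat.stirlingSecond (ν j) (m j) : ℝ)) *
          ((∏ j, b j ^ m j) * ((((∑ j, m j)! : ℕ) : ℝ) * coeff (∑ j, m j) A)) := by
  -- `D_j` maps `T m` to `2π (m_j T m + T (m + e_j))`, and Stirling numbers count the outcome
  set T : (Fin s → ℕ) → SpodAlgebra s := fun m =>
    (∏ i, spodVar b i ^ m i) * spodIncl ((derivative ℝ)^[∑ i, m i] A) with hT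
  have hprod : ∀ (m : Fin s → ℕ) (j : Fin s) (t : Finset (Fin s)),
      spodDeriv b j (∏ i ∈ t, spodVar b i ^ m i) =
        (if j ∈ t then 2 * Real.pi * (m j : ℝ) else 0) • ∏ i ∈ t, spodVar b i ^ m i := by
    intro m j t
    induction t using Finset.induction_on with
    | empty => simp
    | insert i t hi ih =>
      rw [Finset.prod_insert hi, Derivation.leibniz, ih, Derivation.leibniz_pow,
        spodDeriv_spodVar]
      by_cases hij : i = j
      · subst hij
        rw [if_neg hi, if_pos rfl, if_pos (Finset.mem_insert_self _ _)]
        rcases Nat.eq_zero_or_pos (m i) with h0 | h0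
        · simp [h0]
        · obtain ⟨n, hn⟩ := Nat.exists_eq_add_of_le' h0
          simp only [hn, smul_eq_mul, nsmul_eq_mul, Algebra.smul_def, Nat.add_sub_cancel,
            map_mul, map_natCast, map_zero]
          ring
      · rw [if_neg hij]
        have : j ∈ insert i t ↔ j ∈ t := by
          rw [Finset.mem_insert]; exact ⟨fun h => h.resolve_left (Ne.symm hij), Or.inr⟩
        simp only [this, smul_zero, smul_eq_mul, mul_zero, add_zero, mul_smul_comm]
  have hDT : ∀ (j : Fin s) (m : Fin s → ℕ), spodDeriv b j (T m) =
      (2 * Real.pi) • ((m j : ℝ) • T m + T (m + Pi.single j 1)) := by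
    intro j m
    have hsum : ∑ i, (m + Pi.single j 1 : Fin s → ℕ) i = (∑ i, m i) + 1 := by
      simp [Finset.sum_add_distrib]
    have hpr : ∏ i, spodVar b i ^ (m + Pi.single j 1 : Fin s → ℕ) i =
        (∏ i, spodVar b i ^ m i) * spodVar b j := by
      simp only [Pi.add_apply, pow_add, Finset.prod_mul_distrib]
      congr 1
      rw [Finset.prod_eq_single j] <;> simp +contextual
    simp only [hT]
    rw [hsum, hpr, Function.iterate_succ_apply', Derivation.leibniz, hprod, spodDeriv_spodIncl,
      if_pos (Finset.mem_univ j)]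
    simp only [smul_eq_mul, Algebra.smul_def, map_mul]
    ring
  have hstep : ∀ (l : List (Fin s)) (r : ℝ) (ν μ : Fin s → ℕ), (∀ i, μ i = ν i + l.count i) →
      iterOp (fun j => spodDeriv b j) l
        (r • ∑ m ∈ Finset.Iic ν, (∏ i, (Nat.stirlingSecond (ν i) (m i) : ℝ)) • T m) =
      (r * (2 * Real.pi) ^ l.length) • ∑ m ∈ Finset.Iic μ,
        (∏ i, (Nat.stirlingSecond (μ i) (m i) : ℝ)) • T m := by
    intro l
    induction l with
    | nil =>
      intro r ν μ h
      obtain rfl : μ = ν := funext fun i => by simpa using h i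
      simp [iterOp]
    | cons j l ih =>
      intro r ν μ h
      rw [iterOp, Derivation.map_smul, map_sum]
      simp only [Derivation.map_smul, hDT, smul_comm _ (2 * Real.pi)]
      rw [← Finset.smul_sum, ← sum_stirling_step, smul_smul, ih _ _ μ]
      · rw [List.length_cons, pow_succ']
        congr 1
        ring
      · intro i
        rw [h i]
        by_cases hij : i = j
        · subst hij; simp; ring
        · simp [hij, Ne.symm hij]
  have h0 : spodIncl A = (1 : ℝ) • ∑ m ∈ Finset.Iic (0 : Fin s → ℕ),
      (∏ i, (Nat.stirlingSecond ((0 : Fin s → ℕ) i) (m i) : ℝ)) • T m := by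
    have : Finset.Iic (0 : Fin s → ℕ) = {0} := by ext m; simp
    rw [this, Finset.sum_singleton]
    simp [hT]
  rw [h0, hstep (word ν) 1 0 ν fun i => by simp [count_word], one_mul, map_smul, map_sum,
    length_word, smul_eq_mul]
  congr 1
  refine Finset.sum_congr rfl fun m _ => ?_
  rw [map_smul, smul_eq_mul]
  congr 1
  simp only [hT, map_mul, map_prod, map_pow, spodEval_spodVar, spodEval_spodIncl,
    PowerSeries.constantCoeff_iterate_derivative]

end SPOD

/-! ### Values of the target majorants -/

section Values

open PowerSeries (constantCoeff derivative coeff)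

variable {s : ℕ}

lemma coeff_geomSeries_one_sq (n : ℕ) : coeff n (geomSeries 1 ^ 2) = (n : ℝ) + 1 := by
  rw [pow_two, PowerSeries.coeff_mul]
  simp [geomSeries]

lemma podEval_geomSeries (c : ℝ) (b : Fin s → ℝ) (ν : Fin s → ℕ) :
    podEval (iterOp (fun j => podDeriv b j) (word ν) (c • geomSeries 1)) =
      c * podBound 0 ν b := by
  rw [podEval_iterOp, podBound]
  simp [geomSeries]
  ring

lemma podEval_geomSeries_sq (c : ℝ) (b : Fin s → ℝ) (ν : Fin s → ℕ) :
    podEval (iterOp (fun j => podDeriv b j) (word ν) (c • geomSeries 1 ^ 2)) =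
      c * podBound 1 ν b := by
  rw [podEval_iterOp, podBound, map_smul, coeff_geomSeries_one_sq, Nat.factorial_succ,
    smul_eq_mul]
  push_cast
  ring

lemma spodEval_geomSeries (c : ℝ) (b : Fin s → ℝ) (ν : Fin s → ℕ) :
    spodEval (iterOp (fun j => spodDeriv b j) (word ν) (spodIncl (c • geomSeries 1))) =
      c * (2 * Real.pi) ^ (∑ j, ν j) * spodSum 0 ν b := by
  rw [spodEval_iterOp, spodSum, mul_comm c, mul_assoc, Finset.mul_sum (a := c)]
  congr 1
  refine Finset.sum_congr rfl fun m _ => ?_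
  simp [geomSeries]
  ring

lemma spodEval_geomSeries_sq (c : ℝ) (b : Fin s → ℝ) (ν : Fin s → ℕ) :
    spodEval (iterOp (fun j => spodDeriv b j) (word ν) (spodIncl (c • geomSeries 1 ^ 2))) =
      c * (2 * Real.pi) ^ (∑ j, ν j) * spodSum 1 ν b := by
  rw [spodEval_iterOp, spodSum, mul_comm c, mul_assoc, Finset.mul_sum (a := c)]
  congr 1
  refine Finset.sum_congr rfl fun m _ => ?_
  rw [map_smul, coeff_geomSeries_one_sq, Nat.factorial_succ, smul_eq_mul]
  push_cast
  ring

/-- The derivatives of the squared difference of two functions with the common majorant `a` are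
bounded by those of `(a + a)²`. -/
lemma abs_mixedDeriv_sub_sq_le {𝓐 : Type*} [CommRing 𝓐] [Algebra ℝ 𝓐]
    {D : Fin s → Derivation ℝ 𝓐 𝓐} {ε : 𝓐 →ₐ[ℝ] ℝ} {F G : (Fin s → ℝ) → ℝ} {a : 𝓐}
    (hF : ContDiffOn ℝ ∞ F (unitCube s)) (hG : ContDiffOn ℝ ∞ G (unitCube s))
    (hFa : ∀ μ : Fin s → ℕ, ∀ y ∈ unitCube s,
      |mixedDeriv μ F y| ≤ ε (iterOp (fun j => D j) (word μ) a))
    (hGa : ∀ μ : Fin s → ℕ, ∀ y ∈ unitCube s,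
      |mixedDeriv μ G y| ≤ ε (iterOp (fun j => D j) (word μ) a))
    (ν : Fin s → ℕ) {y : Fin s → ℝ} (hy : y ∈ unitCube s) :
    |mixedDeriv ν (fun x => (G x - F x) ^ 2) y| ≤
      ε (iterOp (fun j => D j) (word ν) ((a + a) * (a + a))) := by
  have h1 : IsMajorant D ε (word ν) (fun x => G x + -F x) (a + a) :=
    (isMajorant_word hGa ν).add hG hF.neg ((isMajorant_word hFa ν).neg hF)
  have h2 := (h1.mul (hG.add hF.neg) (hG.add hF.neg) h1).bound hy
  rw [← mixedDeriv_eq_iterOp] at h2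
  simpa only [← sub_eq_add_neg, ← pow_two] using h2

lemma HasPODBound.sub_sq {N : ℕ} {C : ℝ} {b : Fin s → ℝ} {F G : (Fin s → ℝ) → (Fin N → ℝ)}
    (hF : HasPODBound C b F) (hG : HasPODBound C b G) (p : Fin N) (ν : Fin s → ℕ)
    {y : Fin s → ℝ} (hy : y ∈ unitCube s) :
    |mixedDeriv ν (fun x => (G x p - F x p) ^ 2) y| ≤ 4 * C ^ 2 * podBound 1 ν b := by
  have h := abs_mixedDeriv_sub_sq_le (D := podDeriv b) (ε := podEval) (a := C • geomSeries 1)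
    (contDiffOn_pi.1 hF.1 p) (contDiffOn_pi.1 hG.1 p)
    (fun μ y hy => by rw [podEval_geomSeries]; exact hF.2 μ p y hy)
    (fun μ y hy => by rw [podEval_geomSeries]; exact hG.2 μ p y hy) ν hy
  have he : (C • geomSeries 1 + C • geomSeries 1) * (C • geomSeries 1 + C • geomSeries 1) =
      (4 * C ^ 2) • geomSeries 1 ^ 2 := by
    simp only [PowerSeries.smul_eq_C_mul, map_mul, map_pow, map_ofNat]; ring
  rwa [he, podEval_geomSeries_sq] at h

lemma HasPeriodicSPODBound.sub_sq {N : ℕ} {C : ℝ} {b : Fin s → ℝ}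
    {F G : (Fin s → ℝ) → (Fin N → ℝ)}
    (hF : HasPeriodicSPODBound C b F) (hG : HasPeriodicSPODBound C b G) (p : Fin N)
    (ν : Fin s → ℕ) {y : Fin s → ℝ} (hy : y ∈ unitCube s) :
    |mixedDeriv ν (fun x => (G x p - F x p) ^ 2) y| ≤
      4 * C ^ 2 * (2 * Real.pi) ^ (∑ j, ν j) * spodSum 1 ν b := by
  have h := abs_mixedDeriv_sub_sq_le (D := spodDeriv b) (ε := spodEval)
    (a := spodIncl (C • geomSeries 1))
    (contDiff_pi.1 hF.1 p).contDiffOn (contDiff_pi.1 hG.1 p).contDiffOn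
    (fun μ y hy => by rw [spodEval_geomSeries]; exact hF.2.2 μ p y hy)
    (fun μ y hy => by rw [spodEval_geomSeries]; exact hG.2.2 μ p y hy) ν hy
  have he : (C • geomSeries 1 + C • geomSeries 1) * (C • geomSeries 1 + C • geomSeries 1) =
      (4 * C ^ 2) • geomSeries 1 ^ 2 := by
    simp only [PowerSeries.smul_eq_C_mul, map_mul, map_pow, map_ofNat]; ring
  rwa [← map_add, ← map_mul, he, spodEval_geomSeries_sq] at h

end Values

/-! ### Derivative bounds for the networks -/

section Networks

open PowerSeries (constantCoeff derivative coeff)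

variable {s : ℕ}

/-- Linear functions of `y` enter through their first derivatives, which are constant. -/
lemma isMajorant_const (b : Fin s → ℝ) {w r : ℝ} (h : |w| ≤ r) (l : List (Fin s)) :
    IsMajorant (podDeriv b) podEval l (fun _ => w) (PowerSeries.C r) := by
  induction l generalizing w r with
  | nil => exact fun y _ => by simpa [podEval_apply] using h
  | cons j l ih =>
    refine ⟨ih h, ?_⟩
    rw [isMajorant_congr (partialDeriv_const j w), podDeriv_apply, PowerSeries.derivative_C,
      mul_zero, ← map_zero PowerSeries.C]
    exact ih (by simp)

/-- Each derivative in direction `j` shifts the phase by `π / 2` and contributes a factor `2π`, on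
both sides. -/
lemma isMajorant_cos (b : Fin s → ℝ) (j : Fin s) {w r : ℝ} (α : ℝ) (h : |w| ≤ r * b j)
    (l : List (Fin s)) :
    IsMajorant (spodDeriv b) spodEval l (fun y => w * Real.cos (2 * Real.pi * y j + α))
      (r • spodVar b j) := by
  induction l generalizing w r α with
  | nil =>
    intro y _
    rw [map_smul, spodEval_spodVar, abs_mul, smul_eq_mul]
    exact (mul_le_of_le_one_right (abs_nonneg _) (Real.abs_cos_le_one _)).trans h
  | cons i l ih =>
    refine ⟨ih α h, ?_⟩
    rw [Derivation.map_smul, spodDeriv_spodVar]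
    by_cases hij : j = i
    · subst hij
      rw [if_pos rfl, smul_smul]
      have hd : EqOn (partialDeriv j fun y : Fin s → ℝ => w * Real.cos (2 * Real.pi * y j + α))
          (fun y => (2 * Real.pi * w) * Real.cos (2 * Real.pi * y j + (α + Real.pi / 2)))
          (unitCube s) := by
        intro y hy
        refine partialDeriv_eq_of_hasDerivWithinAt hy (HasDerivAt.hasDerivWithinAt ?_)
        simp only [Function.update_self]
        have h1 : HasDerivAt (fun t : ℝ => 2 * Real.pi * t + α) (2 * Real.pi) (y j) := by
          simpa using ((hasDerivAt_id (y j)).const_mul (2 * Real.pi)).add_const α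
        refine (h1.cos.const_mul w).congr_deriv ?_
        rw [← add_assoc, Real.cos_add_pi_div_two]
        ring
      rw [isMajorant_congr hd]
      refine ih _ ?_
      rw [abs_mul, abs_of_pos Real.two_pi_pos]
      nlinarith [Real.two_pi_pos]
    · rw [if_neg hij, smul_zero, ← zero_smul ℝ (spodVar b j)]
      have hd : EqOn (partialDeriv i fun y : Fin s → ℝ => w * Real.cos (2 * Real.pi * y j + α))
          (fun y => 0 * Real.cos (2 * Real.pi * y j + 0)) (unitCube s) := by
        intro y hy
        refine partialDeriv_eq_of_hasDerivWithinAt hy ?_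
        simp only [Function.update_of_ne hij, zero_mul]
        exact hasDerivWithinAt_const _ _ _
      rw [isMajorant_congr hd]
      exact ih 0 (by simp)

/-- The coefficients of the Möbius majorant against those of `C / (1 - X)`; this is where
`P / S ≤ C` and `S β_j ≤ b_j` enter. -/
lemma prod_pow_mul_coeff_layerSeries_le {P S C : ℝ} {β b : Fin s → ℝ} (hS : 0 < S)
    (hC : P / S ≤ C) (hβ : ∀ j, 0 ≤ β j) (hβb : ∀ j, β j ≤ b j / S) (m : Fin s → ℕ)
    (hC0 : 0 ≤ C) :
    (∏ j, β j ^ m j) * coeff (∑ j, m j) (layerSeries P S) ≤ C * ∏ j, b j ^ m j := by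
  have hle : ∀ j, S * β j ≤ b j := fun j => by
    have := (le_div_iff₀ hS).1 (hβb j); linarith
  have hprod : S ^ (∑ j, m j) * ∏ j, β j ^ m j ≤ ∏ j, b j ^ m j := by
    rw [← Finset.prod_pow_eq_pow_sum, ← Finset.prod_mul_distrib]
    refine Finset.prod_le_prod (fun j _ => by have := hβ j; positivity) fun j _ => ?_
    rw [← mul_pow]
    exact pow_le_pow_left₀ (mul_nonneg hS.le (hβ j)) (hle j) _
  have hnn : 0 ≤ S ^ (∑ j, m j) * ∏ j, β j ^ m j :=
    mul_nonneg (pow_nonneg hS.le _) (Finset.prod_nonneg fun j _ => pow_nonneg (hβ j) _)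
  rcases hn : ∑ j, m j with _ | n
  · rw [layerSeries, mul_assoc, PowerSeries.coeff_C_mul]
    simp only [PowerSeries.coeff_zero_eq_constantCoeff, map_mul, PowerSeries.constantCoeff_X,
      zero_mul, mul_zero]
    exact mul_nonneg hC0 (hnn.trans hprod)
  · rw [coeff_layerSeries_succ]
    calc (∏ j, β j ^ m j) * (P * S ^ n) = P / S * (S ^ (n + 1) * ∏ j, β j ^ m j) := by
          field_simp
          ring
      _ ≤ C * ∏ j, b j ^ m j := by
          rw [← hn]
          exact mul_le_mul hC hprod hnn hC0

lemma abs_apply_le_cubeSupNorm {N : ℕ} {F : (Fin s → ℝ) → (Fin N → ℝ)} (hF : Continuous F)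
    {y : Fin s → ℝ} (hy : y ∈ unitCube s) (p : Fin N) : |F y p| ≤ cubeSupNorm F := by
  have hb : BddAbove (range fun y : unitCube s => ‖F y‖) := by
    have h := (isCompact_Icc (a := (0 : Fin s → ℝ)) (b := 1)).bddAbove_image
      hF.norm.continuousOn
    rwa [image_eq_range] at h
  exact (norm_le_pi_norm (F y) p).trans (le_ciSup hb ⟨y, hy⟩)

/-- A majorant of the first derivatives bounds all derivatives of positive order. -/
lemma abs_mixedDeriv_le_of_isMajorant {𝓐 : Type*} [CommRing 𝓐] [Algebra ℝ 𝓐]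
    {D : Fin s → Derivation ℝ 𝓐 𝓐} {ε : 𝓐 →ₐ[ℝ] ℝ} {F : (Fin s → ℝ) → ℝ} {a : 𝓐}
    (h : ∀ j l, IsMajorant D ε l (partialDeriv j F) (D j a)) {ν : Fin s → ℕ} (hν : ν ≠ 0)
    {y : Fin s → ℝ} (hy : y ∈ unitCube s) :
    |mixedDeriv ν F y| ≤ ε (iterOp (fun j => D j) (word ν) a) := by
  rw [mixedDeriv_eq_iterOp]
  rcases hw : word ν with _ | ⟨j, l⟩
  · refine absurd (funext fun j => ?_) hν
    rw [← count_word ν j, hw]; rfl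
  · exact (h j l).bound hy

lemma mixedDeriv_zero (F : (Fin s → ℝ) → ℝ) : mixedDeriv 0 F = F := by
  have : word (0 : Fin s → ℕ) = [] := List.eq_nil_of_length_eq_zero (by simp [length_word])
  rw [mixedDeriv_eq_iterOp, this]; rfl

lemma constP_pos {ξ τ : ℝ} {R : ℕ → ℝ} {L : ℕ} (hξ : 0 < ξ) (hτ : 0 < τ)
    (hR : ∀ ℓ, 1 ≤ ℓ → ℓ ≤ L → 0 < R ℓ) {k : ℕ} (hk : k ≤ L) : 0 < constP ξ τ R k :=
  Finset.prod_pos fun t ht => by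
    rw [Finset.mem_Icc] at ht
    have := hR t ht.1 (ht.2.trans hk)
    positivity

lemma constS_pos {ξ τ : ℝ} {R : ℕ → ℝ} {L : ℕ} (hL : 1 ≤ L) (hξ : 0 < ξ) (hτ : 0 < τ)
    (hR : ∀ ℓ, 1 ≤ ℓ → ℓ ≤ L → 0 < R ℓ) : 0 < constS ξ τ R L :=
  mul_pos hτ <| Finset.sum_pos
    (fun _ hk => constP_pos hξ hτ hR (Finset.mem_range.1 hk).le)
    ⟨0, Finset.mem_range.2 hL⟩

lemma stirling_prod_nonneg (ν m : Fin s → ℕ) :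
    (0 : ℝ) ≤ ∏ j, (Nat.stirlingSecond (ν j) (m j) : ℝ) :=
  Finset.prod_nonneg fun _ _ => Nat.cast_nonneg _

variable {d : ℕ → ℕ} {L : ℕ} {θ : NetParams d} {σ : ℝ → ℝ} {β b : Fin (d 0) → ℝ} {R : ℕ → ℝ}
  {ξ τ C : ℝ}

theorem hasPODBound_dnn (hL : 1 ≤ L) (hβ_pos : ∀ j, 0 < β j)
    (hR_pos : ∀ ℓ, 1 ≤ ℓ → ℓ ≤ L → 0 < R ℓ) (hξ : 0 < ξ) (hτ : 0 < τ)
    (hβ : ∀ p j, |θ.W 0 p j| ≤ β j)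
    (hR : ∀ ℓ, 1 ≤ ℓ → ℓ ≤ L → ∀ p, ∑ q, |θ.W ℓ p q| ≤ R ℓ) (hσ : ContDiff ℝ ∞ σ)
    (hσA : ∀ n : ℕ, 1 ≤ n → ∀ x : ℝ, |iteratedDeriv n σ x| ≤ ξ * τ ^ n * (n ! : ℝ))
    (hC : 0 < C) (hβb : ∀ j, β j ≤ b j / constS ξ τ R L)
    (hCL : constC ξ τ R L (dnn θ σ L) ≤ C) : HasPODBound C b (dnn θ σ L) := by
  refine ⟨(contDiff_dnn θ hσ L).contDiffOn, fun ν p y hy => ?_⟩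
  rcases eq_or_ne ν 0 with rfl | hν
  · rw [mixedDeriv_zero]
    refine (abs_apply_le_cubeSupNorm (contDiff_dnn θ hσ L).continuous hy p).trans ?_
    simpa [podBound] using (le_max_left _ _).trans hCL
  · have hX : ∀ j, podDeriv β j (AlgHom.id ℝ _ PowerSeries.X) = PowerSeries.C (β j) := fun j => by
      simp [podDeriv_apply]
    have hmaj := (isMajorant_dnn (D := podDeriv β) (ε := podEval) (ι := AlgHom.id ℝ _)
      (c := fun j => PowerSeries.C (β j)) (fun j A => podDeriv_apply β j A) (fun A => rfl)
      hξ hτ hσ hσA (θ := θ) (x := id) contDiff_id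
      (fun j l => by rw [hX]; exact isMajorant_const β (by simpa using (hβ_pos j).le) l)
      (fun p j l => by
        have hd := partialDeriv_sum (s := d 0) (f := fun q y => y q) (θ.W 0 p) (θ.v 0 p)
          (fun q => by fun_prop) j
        have hd' : EqOn (partialDeriv j fun y => dnn θ σ 0 (id y) p) (fun _ => θ.W 0 p j)
            (unitCube (d 0)) := by
          intro y hy
          refine (hd hy).trans ?_
          have hq : ∀ q, partialDeriv j (fun y : Fin (d 0) → ℝ => y q) y =
              if q = j then 1 else 0 := fun q =>
            partialDeriv_eq_of_hasDerivWithinAt hy <| by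
              by_cases hqj : q = j
              · subst hqj
                simp only [Function.update_self, if_true]
                exact hasDerivWithinAt_id _ _
              · simpa [hqj] using hasDerivWithinAt_const (y j) (Icc (0 : ℝ) 1) (y q)
          simp [hq]
        rw [isMajorant_congr hd', hX]
        exact isMajorant_const β (hβ p j) l)
      L hR_pos hR L le_rfl).2 p
    refine (abs_mixedDeriv_le_of_isMajorant hmaj hν hy).trans ?_
    rw [AlgHom.id_apply, podEval_iterOp, podBound, mul_assoc, add_zero, mul_left_comm C]
    exact mul_le_mul_of_nonneg_left (prod_pow_mul_coeff_layerSeries_le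
      (constS_pos hL hξ hτ hR_pos)
      ((le_max_right _ _).trans hCL) (fun j => (hβ_pos j).le) hβb ν hC.le) (Nat.cast_nonneg _)

theorem hasPeriodicSPODBound_periodicDnn (hL : 1 ≤ L) (hβ_pos : ∀ j, 0 < β j)
    (hR_pos : ∀ ℓ, 1 ≤ ℓ → ℓ ≤ L → 0 < R ℓ) (hξ : 0 < ξ) (hτ : 0 < τ)
    (hβ : ∀ p j, |θ.W 0 p j| ≤ β j)
    (hR : ∀ ℓ, 1 ≤ ℓ → ℓ ≤ L → ∀ p, ∑ q, |θ.W ℓ p q| ≤ R ℓ) (hσ : ContDiff ℝ ∞ σ)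
    (hσA : ∀ n : ℕ, 1 ≤ n → ∀ x : ℝ, |iteratedDeriv n σ x| ≤ ξ * τ ^ n * (n ! : ℝ))
    (hC : 0 < C) (hβb : ∀ j, β j ≤ b j / constS ξ τ R L)
    (hCL : constC ξ τ R L (periodicDnn θ σ L) ≤ C) :
    HasPeriodicSPODBound C b (periodicDnn θ σ L) := by
  have hx : ContDiff ℝ ∞ fun (y : Fin (d 0) → ℝ) j => Real.sin (2 * Real.pi * y j) :=
    contDiff_pi.2 fun j => Real.contDiff_sin.comp (contDiff_const.mul (contDiff_apply ℝ ℝ j))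
  have hsm : ContDiff ℝ ∞ (periodicDnn θ σ L) := (contDiff_dnn θ hσ L).comp hx
  refine ⟨hsm, fun j y => ?_, fun ν p y hy => ?_⟩
  · unfold periodicDnn
    congr 1
    ext i
    by_cases hij : i = j
    · subst hij
      rw [Pi.add_apply, Pi.single_eq_same, mul_add, mul_one, Real.sin_add_two_pi]
    · simp [hij]
  rcases eq_or_ne ν 0 with rfl | hν
  · rw [mixedDeriv_zero]
    refine (abs_apply_le_cubeSupNorm hsm.continuous hy p).trans ?_
    have h1 : Finset.Iic (0 : Fin (d 0) → ℕ) = {0} := by ext m; simp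
    simpa [spodSum, h1] using (le_max_left _ _).trans hCL
  · have hX : ∀ j, spodDeriv β j (spodIncl PowerSeries.X) =
        (2 * Real.pi) • spodVar β j := fun j => by
      simp [spodDeriv_spodIncl]
    have hmaj := (isMajorant_dnn (D := spodDeriv β) (ε := spodEval) (ι := spodIncl)
      (c := fun j => (2 * Real.pi) • spodVar β j) (spodDeriv_spodIncl β) spodEval_spodIncl
      hξ hτ hσ hσA (θ := θ) hx
      (fun j l => by
        rw [hX]
        simpa using isMajorant_cos β j (w := 0) (r := 2 * Real.pi) 0
          (by have := hβ_pos j; have := Real.pi_pos; rw [abs_zero]; positivity) l)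
      (fun p j l => by
        have hd := partialDeriv_sum (s := d 0)
          (f := fun q y => Real.sin (2 * Real.pi * y q)) (θ.W 0 p) (θ.v 0 p)
          (fun q => by fun_prop) j
        have hd' : EqOn (partialDeriv j fun y : Fin (d 0) → ℝ =>
              dnn θ σ 0 (fun i => Real.sin (2 * Real.pi * y i)) p)
            (fun y => (2 * Real.pi * θ.W 0 p j) * Real.cos (2 * Real.pi * y j + 0))
            (unitCube (d 0)) := by
          intro y hy
          refine (hd hy).trans ?_
          have hq : ∀ q, partialDeriv j
              (fun y : Fin (d 0) → ℝ => Real.sin (2 * Real.pi * y q)) y =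
              if q = j then 2 * Real.pi * Real.cos (2 * Real.pi * y q) else 0 := fun q =>
            partialDeriv_eq_of_hasDerivWithinAt hy <| by
              by_cases hqj : q = j
              · subst hqj
                simp only [Function.update_self, if_true]
                have h1 : HasDerivAt (fun t : ℝ => 2 * Real.pi * t) (2 * Real.pi) (y q) := by
                  simpa using (hasDerivAt_id (y q)).const_mul (2 * Real.pi)
                exact (h1.sin.congr_deriv (by ring)).hasDerivWithinAt
              · simpa [hqj] using hasDerivWithinAt_const (y j) (Icc (0 : ℝ) 1)
                  (Real.sin (2 * Real.pi * y q))
          simp [hq]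
          ring
        rw [isMajorant_congr hd', hX]
        refine isMajorant_cos β j 0 ?_ l
        rw [abs_mul, abs_of_pos Real.two_pi_pos]
        exact mul_le_mul_of_nonneg_left (hβ p j) Real.two_pi_pos.le)
      L hR_pos hR L le_rfl).2 p
    refine (abs_mixedDeriv_le_of_isMajorant hmaj hν hy).trans ?_
    rw [spodEval_iterOp, mul_comm C, mul_assoc, spodSum, Finset.mul_sum (a := C)]
    refine mul_le_mul_of_nonneg_left (Finset.sum_le_sum fun m _ => ?_)
      (pow_nonneg Real.two_pi_pos.le _)
    have h := prod_pow_mul_coeff_layerSeries_le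
      (constS_pos hL hξ hτ hR_pos)
      ((le_max_right _ _).trans hCL) (fun j => (hβ_pos j).le) hβb m hC.le
    have h2 : (0 : ℝ) ≤ ((∑ j, m j)! : ℝ) * ∏ j, (Nat.stirlingSecond (ν j) (m j) : ℝ) :=
      mul_nonneg (Nat.cast_nonneg _) (stirling_prod_nonneg ν m)
    refine le_trans (le_of_eq ?_) ((mul_le_mul_of_nonneg_left h h2).trans (le_of_eq ?_))
    · ring
    · rw [add_zero]; ring

end Networks

/-! ### Weighted norms -/

section Norms

variable {s : ℕ}

/-- The multiindex with entries `α` on `u` and `0` off `u`. -/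
def blockIndex (u : Finset (Fin s)) (α : ℕ) : Fin s → ℕ := fun j => if j ∈ u then α else 0

lemma prod_eq_prod_subtype {M : Type*} [CommMonoid M] (u : Finset (Fin s)) (f : Fin s → M)
    (h : ∀ j, j ∉ u → f j = 1) : ∏ j, f j = ∏ j : {j // j ∈ u}, f j :=
  (Finset.prod_subset (Finset.subset_univ u) fun j _ hj => h j hj).symm.trans
    (Finset.prod_coe_sort u f).symm

lemma sum_eq_sum_subtype {M : Type*} [AddCommMonoid M] (u : Finset (Fin s)) (f : Fin s → M)
    (h : ∀ j, j ∉ u → f j = 0) : ∑ j, f j = ∑ j : {j // j ∈ u}, f j :=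
  (Finset.sum_subset (Finset.subset_univ u) fun j _ hj => h j hj).symm.trans
    (Finset.sum_coe_sort u f).symm

lemma sum_blockIndex (u : Finset (Fin s)) (α : ℕ) : ∑ j, blockIndex u α j = α * u.card := by
  simp [blockIndex, mul_comm]

lemma podBound_blockIndex_one (k : ℕ) (u : Finset (Fin s)) (b : Fin s → ℝ) :
    podBound k (blockIndex u 1) b = ((u.card + k)! : ℝ) * ∏ j ∈ u, b j := by
  rw [podBound, sum_blockIndex, one_mul, prod_eq_prod_subtype u, ← Finset.prod_coe_sort u]
  · congr 1
    exact Finset.prod_congr rfl fun j _ => by simp [blockIndex]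
  · intro j hj
    simp [blockIndex, hj]

lemma spodSum_blockIndex (k α : ℕ) (u : Finset (Fin s)) (b : Fin s → ℝ) :
    spodSum k (blockIndex u α) b =
      spodSum k (fun _ : {j // j ∈ u} => α) (fun j => b j) := by
  have hoff : ∀ m ∈ Finset.Iic (blockIndex u α), ∀ j, j ∉ u → m j = 0 := fun m hm j hj => by
    have := (Finset.mem_Iic.1 hm) j
    simpa [blockIndex, hj] using this
  refine Finset.sum_bij' (fun m _ j => m j)
    (fun m _ j => if h : j ∈ u then m ⟨j, h⟩ else 0) (fun m hm => ?_) (fun m hm => ?_)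
    (fun m hm => ?_) (fun m _ => ?_) fun m hm => ?_
  · rw [Finset.mem_Iic] at hm ⊢
    intro j
    simpa [blockIndex] using hm j
  · rw [Finset.mem_Iic] at hm ⊢
    intro j
    by_cases hj : j ∈ u
    · simpa [blockIndex, hj] using hm ⟨j, hj⟩
    · simp [blockIndex, hj]
  · ext j
    by_cases hj : j ∈ u
    · simp [hj]
    · simp [hj, hoff m hm j hj]
  · ext j
    simp
  · rw [sum_eq_sum_subtype u m (hoff m hm),
      prod_eq_prod_subtype u (fun j => b j ^ m j) fun j hj => by rw [hoff m hm j hj, pow_zero],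
      prod_eq_prod_subtype u (fun j => (Nat.stirlingSecond (blockIndex u α j) (m j) : ℝ))
        fun j hj => by simp [hoff m hm j hj, blockIndex, hj]]
    congr 2
    exact Finset.prod_congr rfl fun j _ => by simp [blockIndex]

lemma merge_mem_unitCube (u : Finset (Fin s)) {y : {j // j ∈ u} → ℝ} {z : {j // j ∉ u} → ℝ}
    (hy : y ∈ Icc (0 : {j // j ∈ u} → ℝ) 1) (hz : z ∈ Icc (0 : {j // j ∉ u} → ℝ) 1) :
    merge u y z ∈ unitCube s := by
  constructor <;> intro j <;> by_cases h : j ∈ u <;> simp only [merge, h, dite_true, dite_false]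
  · exact hy.1 ⟨j, h⟩
  · exact hz.1 ⟨j, h⟩
  · exact hy.2 ⟨j, h⟩
  · exact hz.2 ⟨j, h⟩

lemma volume_Icc_zero_one {κ : Type*} [Fintype κ] :
    (volume (Icc (0 : κ → ℝ) 1)) = 1 := by
  simp [Real.volume_Icc_pi]

/-- A bound on the integrand over a cube of volume `1` is a bound on the integral. -/
lemma norm_integral_cube_le {κ E : Type*} [Fintype κ] [NormedAddCommGroup E] [NormedSpace ℝ E]
    {f : (κ → ℝ) → E} {B : ℝ} (h : ∀ y ∈ Icc (0 : κ → ℝ) 1, ‖f y‖ ≤ B) :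
    ‖∫ y in Icc (0 : κ → ℝ) 1, f y‖ ≤ B := by
  have := norm_setIntegral_le_of_norm_le_const (μ := volume) (s := Icc (0 : κ → ℝ) 1)
    (by rw [volume_Icc_zero_one]; exact ENNReal.one_lt_top) h
  simpa [Measure.real, volume_Icc_zero_one] using this

variable {α : ℕ} {γ : Finset (Fin s) → ℝ} {F : (Fin s → ℝ) → ℝ} {B : Finset (Fin s) → ℝ}

lemma abs_projDeriv_le {u : Finset (Fin s)} {M : ℝ}
    (h : ∀ y ∈ unitCube s, |mixedDeriv (blockIndex u α) F y| ≤ M)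
    {y : {j // j ∈ u} → ℝ} (hy : y ∈ Icc (0 : {j // j ∈ u} → ℝ) 1) :
    |projDeriv α u F y| ≤ M := by
  rw [projDeriv, ← Real.norm_eq_abs]
  exact norm_integral_cube_le fun _ hz => h _ (merge_mem_unitCube u hy hz)

lemma sobolevNorm_sq_le (hγ : ∀ u, 0 < γ u)
    (h : ∀ u, ∀ y ∈ unitCube s, |mixedDeriv (blockIndex u α) F y| ≤ B u) :
    sobolevNorm α γ F ^ 2 ≤ ∑ u, (1 / γ u) * B u ^ 2 := by
  rw [sobolevNorm, Real.sq_sqrt]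
  · refine Finset.sum_le_sum fun u _ =>
      mul_le_mul_of_nonneg_left ?_ (one_div_pos.2 (hγ u)).le
    refine (Real.le_norm_self _).trans (norm_integral_cube_le fun y hy => ?_)
    rw [Real.norm_of_nonneg (by positivity)]
    exact pow_le_pow_left₀ (abs_nonneg _) (abs_projDeriv_le (h u) hy) 2
  · exact Finset.sum_nonneg fun u _ => mul_nonneg (one_div_pos.2 (hγ u)).le
      (integral_nonneg fun y => by positivity)

lemma korobovDerivNorm_le (hγ : ∀ u, 0 < γ u)
    (h : ∀ u, ∀ y ∈ unitCube s, |mixedDeriv (blockIndex u α) F y| ≤ B u) :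
    korobovDerivNorm α γ F ≤ ⨆ u, (1 / γ u) * B u := by
  refine ciSup_le fun u => (mul_le_mul_of_nonneg_left ?_ (one_div_pos.2 (hγ u)).le).trans
    (le_ciSup (f := fun u => (1 / γ u) * B u) (Finite.bddAbove_range _) u)
  refine (Real.le_norm_self _).trans (norm_integral_cube_le fun y hy => ?_)
  rw [Real.norm_of_nonneg (abs_nonneg _)]
  exact abs_projDeriv_le (h u) hy

end Norms

/-! ### Fourier coefficients of derivatives -/

section Fourier

variable {s : ℕ}

/-- The exponent `-2πi h·y` of the character `exp (-2πi h·y)`, as a linear map. -/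
noncomputable def fourierExponent (h : Fin s → ℤ) : (Fin s → ℝ) →L[ℝ] ℂ :=
  ∑ k, (-(2 * Real.pi * Complex.I * (h k : ℂ))) •
    (Complex.ofRealCLM.comp (ContinuousLinearMap.proj k))

lemma fourierExponent_apply (h : Fin s → ℤ) (y : Fin s → ℝ) :
    fourierExponent h y = -(2 * Real.pi * Complex.I * ∑ j, (h j : ℂ) * (y j : ℂ)) := by
  simp [fourierExponent, Finset.mul_sum, mul_assoc]

lemma fourierExponent_single (h : Fin s → ℤ) (j : Fin s) :
    fourierExponent h (Pi.single j 1) = -(2 * Real.pi * Complex.I * (h j : ℂ)) := by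
  rw [fourierExponent_apply]
  congr 2
  rw [Finset.sum_eq_single j] <;> simp +contextual

lemma exp_fourierExponent_add_single (h : Fin s → ℤ) (j : Fin s) (y : Fin s → ℝ) :
    Complex.exp (fourierExponent h (y + Pi.single j 1)) =
      Complex.exp (fourierExponent h y) := by
  rw [map_add, fourierExponent_single, Complex.exp_add]
  have : Complex.exp (-(2 * Real.pi * Complex.I * (h j : ℂ))) = 1 := by
    rw [← mul_neg, ← Int.cast_neg, mul_comm]
    exact Complex.exp_int_mul_two_pi_mul_I _
  rw [this, mul_one]

/-- The integral over the cube of a partial derivative of a smooth periodic function vanishes, by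
the divergence theorem: the contributions of opposite faces cancel. -/
lemma integral_fderiv_periodic_eq_zero {g : (Fin s → ℝ) → ℂ} (hg : ContDiff ℝ ∞ g) (j : Fin s)
    (hper : ∀ y, g (y + Pi.single j 1) = g y) :
    ∫ y in Icc (0 : Fin s → ℝ) 1, fderiv ℝ g y (Pi.single j 1) = 0 := by
  cases s with
  | zero => exact j.elim0
  | succ n =>
    have hd := integral_divergence_of_hasFDerivAt_off_countable' (0 : Fin (n + 1) → ℝ) 1
      zero_le_one (fun i => if i = j then g else 0)
      (fun i => if i = j then fderiv ℝ g else 0) ∅ countable_empty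
      (fun i => by
        split_ifs
        · exact hg.continuous.continuousOn
        · exact continuousOn_const)
      (fun x _ i => by
        by_cases hij : i = j
        · simpa [hij] using ((hg.differentiable (by simp)) x).hasFDerivAt
        · simp only [if_neg hij]
          exact hasFDerivAt_const (0 : ℂ) x)
      (by
        refine Continuous.integrableOn_Icc (continuous_finsetSum _ fun i _ => ?_)
        by_cases hij : i = j
        · simp only [hij, if_true]
          exact (hg.continuous_fderiv (by simp)).clm_apply continuous_const
        · simp only [hij, if_false]
          exact continuous_const)
    have hsum : ∀ x, (∑ i, (if i = j then fderiv ℝ g else 0) x (Pi.single i 1)) =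
        fderiv ℝ g x (Pi.single j 1) := fun x => by
      rw [Finset.sum_eq_single j] <;> simp +contextual
    simp only [hsum] at hd
    rw [hd]
    refine Finset.sum_eq_zero fun i _ => ?_
    by_cases hij : i = j
    · subst hij
      simp only [if_true]
      rw [sub_eq_zero]
      refine integral_congr_ae (Filter.Eventually.of_forall fun x => ?_)
      simp only [Pi.one_apply, Pi.zero_apply]
      rw [← hper (i.insertNth 0 x)]
      congr 1
      ext k
      refine Fin.succAboveCases i ?_ (fun k => ?_) k <;> simp
    · simp [hij]

lemma partialDeriv_eq_fderiv {F : (Fin s → ℝ) → ℝ} (hF : ContDiff ℝ ∞ F) (j : Fin s) :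
    EqOn (fun y => fderiv ℝ F y (Pi.single j 1)) (partialDeriv j F) (unitCube s) := fun y hy => by
  rw [partialDeriv_eq_fderivWithin (hF.differentiable (by simp)).differentiableOn hy,
    fderivWithin_eq_fderiv (uniqueDiffOn_unitCube s y hy) (hF.differentiable (by simp) y)]

lemma cubeFourierCoeff_fderiv {F : (Fin s → ℝ) → ℝ} (hF : ContDiff ℝ ∞ F)
    (j : Fin s) (hper : ∀ y, F (y + Pi.single j 1) = F y) (h : Fin s → ℤ) :
    cubeFourierCoeff (fun y => fderiv ℝ F y (Pi.single j 1)) h =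
      2 * Real.pi * Complex.I * (h j : ℂ) * cubeFourierCoeff F h := by
  have hexp : ContDiff ℝ ∞ fun y => Complex.exp (fourierExponent h y) :=
    Complex.contDiff_exp.comp (fourierExponent h).contDiff
  have hofReal : ContDiff ℝ ∞ fun y => (F y : ℂ) := Complex.ofRealCLM.contDiff.comp hF
  have hder : ∀ y, fderiv ℝ (fun y => (F y : ℂ) * Complex.exp (fourierExponent h y)) y
      (Pi.single j 1) =
      (fderiv ℝ F y (Pi.single j 1) : ℂ) * Complex.exp (fourierExponent h y) -
        2 * Real.pi * Complex.I * (h j : ℂ) * (F y * Complex.exp (fourierExponent h y)) := by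
    intro y
    have h1 : HasFDerivAt (fun y => (F y : ℂ)) (Complex.ofRealCLM.comp (fderiv ℝ F y)) y :=
      Complex.ofRealCLM.hasFDerivAt.comp y (hF.differentiable (by simp) y).hasFDerivAt
    rw [(h1.fun_mul (fourierExponent h).hasFDerivAt.cexp).fderiv]
    simp [fourierExponent_single]
    ring
  have hzero := integral_fderiv_periodic_eq_zero (hofReal.mul hexp) j
    fun y => by rw [hper, exp_fourierExponent_add_single]
  simp only [hder] at hzero
  rw [integral_sub, sub_eq_zero, integral_const_mul] at hzero
  · simpa only [cubeFourierCoeff, unitCube, fourierExponent_apply] using hzero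
  · refine Continuous.integrableOn_Icc (Continuous.mul ?_ hexp.continuous)
    exact Complex.continuous_ofReal.comp
      ((hF.continuous_fderiv (by simp)).clm_apply continuous_const)
  · exact Continuous.integrableOn_Icc (continuous_const.mul (hofReal.mul hexp).continuous)

lemma iterOp_partialDeriv_congr (l : List (Fin s)) {F G : (Fin s → ℝ) → ℝ}
    (h : EqOn F G (unitCube s)) :
    EqOn (iterOp partialDeriv l F) (iterOp partialDeriv l G) (unitCube s) := by
  induction l generalizing F G with
  | nil => exact h
  | cons j l ih => exact ih (partialDeriv_congr j h)

lemma cubeFourierCoeff_iterOp (l : List (Fin s)) {F : (Fin s → ℝ) → ℝ} (hF : ContDiff ℝ ∞ F)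
    (hper : ∀ (j : Fin s) (y : Fin s → ℝ), F (y + Pi.single j 1) = F y) (h : Fin s → ℤ) :
    cubeFourierCoeff (iterOp partialDeriv l F) h =
      (l.map fun j => 2 * Real.pi * Complex.I * (h j : ℂ)).prod * cubeFourierCoeff F h := by
  have hcongr : ∀ {F G : (Fin s → ℝ) → ℝ}, EqOn F G (unitCube s) →
      cubeFourierCoeff F h = cubeFourierCoeff G h := fun hFG =>
    setIntegral_congr_fun measurableSet_Icc fun y hy => by simp only [hFG hy]
  induction l generalizing F with
  | nil => simp [iterOp]
  | cons j l ih =>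
    rw [iterOp, hcongr (iterOp_partialDeriv_congr l (partialDeriv_eq_fderiv hF j).symm), ih,
      cubeFourierCoeff_fderiv hF j (hper j), List.map_cons, List.prod_cons]
    · ring
    · exact (hF.fderiv_right (by simp)).clm_apply contDiff_const
    · intro i y
      have : (fun x => F (x + Pi.single i 1)) = F := funext (hper i)
      rw [← fderiv_comp_add_right, this]

/-- The weights `(2π |h_j|)^α` turn `F̂(h)` into the Fourier coefficient of the mixed derivative of
order `α` in the directions of the support of `h`, which is bounded by its supremum. -/
lemma korobovNorm_le {α : ℕ} {γ : Finset (Fin s) → ℝ} {F : (Fin s → ℝ) → ℝ}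
    {B : Finset (Fin s) → ℝ} (hγ : ∀ u, 0 < γ u) (hF : ContDiff ℝ ∞ F)
    (hper : ∀ (j : Fin s) (y : Fin s → ℝ), F (y + Pi.single j 1) = F y)
    (hB : ∀ u, ∀ y ∈ unitCube s, |mixedDeriv (blockIndex u α) F y| ≤ B u) :
    korobovNorm α γ F ≤ ENNReal.ofReal (⨆ u, (1 / γ u) * B u) := by
  refine iSup_le fun h => ENNReal.ofReal_le_ofReal ?_
  set u := Finset.univ.filter fun j => h j ≠ 0
  refine le_trans ?_ (le_ciSup (f := fun u => (1 / γ u) * B u) (Finite.bddAbove_range _) u)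
  rw [mul_assoc]
  refine mul_le_mul_of_nonneg_left ?_ (one_div_pos.2 (hγ u)).le
  have hprod : ‖((word (blockIndex u α)).map fun j => 2 * Real.pi * Complex.I * (h j : ℂ)).prod‖ =
      ∏ j ∈ u, (2 * Real.pi * |(h j : ℝ)|) ^ α := by
    have hn : ∀ j, ‖2 * Real.pi * Complex.I * (h j : ℂ)‖ = 2 * Real.pi * |(h j : ℝ)| := fun j => by
      simp [abs_of_pos Real.pi_pos]
    rw [prod_map_word, norm_prod]
    simp only [norm_pow, hn, blockIndex]
    rw [← Finset.prod_subset (Finset.subset_univ u) fun j _ hj => by rw [if_neg hj, pow_zero]]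
    exact Finset.prod_congr rfl fun j hj => by rw [if_pos hj]
  rw [← hprod, ← norm_mul, ← cubeFourierCoeff_iterOp _ hF hper, ← mixedDeriv_eq_iterOp]
  refine norm_integral_cube_le fun y hy => ?_
  rw [norm_mul, ← fourierExponent_apply]
  have h1 : ‖Complex.exp (fourierExponent h y)‖ = 1 := by
    have he : fourierExponent h y =
        ((-(2 * Real.pi * ∑ j, (h j : ℝ) * y j) : ℝ) : ℂ) * Complex.I := by
      rw [fourierExponent_apply]; push_cast; ring
    rw [he, Complex.norm_exp_ofReal_mul_I]
  rw [h1, mul_one, Complex.norm_real]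
  exact hB u y hy

end Fourier

/-! ### Norm bounds from derivative bounds -/

section Assembly

variable {s : ℕ} {γ : Finset (Fin s) → ℝ} {F : (Fin s → ℝ) → ℝ} {b : Fin s → ℝ} {c : ℝ} {k α : ℕ}

lemma sobolevNorm_one_sq_le_podNormSum (hγ : ∀ u, 0 < γ u)
    (h : ∀ ν : Fin s → ℕ, ∀ y ∈ unitCube s, |mixedDeriv ν F y| ≤ c * podBound k ν b) :
    sobolevNorm 1 γ F ^ 2 ≤ c ^ 2 * podNormSum k γ b := by
  refine (sobolevNorm_sq_le hγ fun u => h (blockIndex u 1)).trans_eq ?_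
  rw [podNormSum, Finset.mul_sum]
  refine Finset.sum_congr rfl fun u _ => ?_
  rw [podBound_blockIndex_one]
  ring

lemma sobolevNorm_sq_le_spodNormSum (hγ : ∀ u, 0 < γ u)
    (h : ∀ ν : Fin s → ℕ, ∀ y ∈ unitCube s,
      |mixedDeriv ν F y| ≤ c * (2 * Real.pi) ^ (∑ j, ν j) * spodSum k ν b) :
    sobolevNorm α γ F ^ 2 ≤ c ^ 2 * spodNormSum k α γ b := by
  refine (sobolevNorm_sq_le hγ fun u => h (blockIndex u α)).trans_eq ?_
  rw [spodNormSum, Finset.mul_sum]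
  refine Finset.sum_congr rfl fun u _ => ?_
  rw [spodSum_blockIndex, sum_blockIndex, mul_assoc 2 α, pow_mul' _ 2]
  ring

lemma iSup_eq_mul_spodNormMax (hc : 0 ≤ c) :
    ⨆ u : Finset (Fin s), (1 / γ u) *
      (c * (2 * Real.pi) ^ (∑ j, blockIndex u α j) * spodSum k (blockIndex u α) b) =
      c * spodNormMax k α γ b := by
  rw [spodNormMax, Real.mul_iSup_of_nonneg hc]
  congr 1
  ext u
  rw [spodSum_blockIndex, sum_blockIndex]
  ring

lemma korobovDerivNorm_le_spodNormMax (hγ : ∀ u, 0 < γ u) (hc : 0 ≤ c)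
    (h : ∀ ν : Fin s → ℕ, ∀ y ∈ unitCube s,
      |mixedDeriv ν F y| ≤ c * (2 * Real.pi) ^ (∑ j, ν j) * spodSum k ν b) :
    korobovDerivNorm α γ F ≤ c * spodNormMax k α γ b :=
  (korobovDerivNorm_le hγ fun u => h (blockIndex u α)).trans_eq (iSup_eq_mul_spodNormMax hc)

lemma korobovNorm_le_spodNormMax (hγ : ∀ u, 0 < γ u) (hc : 0 ≤ c) (hF : ContDiff ℝ ∞ F)
    (hper : ∀ (j : Fin s) (y : Fin s → ℝ), F (y + Pi.single j 1) = F y)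
    (h : ∀ ν : Fin s → ℕ, ∀ y ∈ unitCube s,
      |mixedDeriv ν F y| ≤ c * (2 * Real.pi) ^ (∑ j, ν j) * spodSum k ν b) :
    korobovNorm α γ F ≤ ENNReal.ofReal (c * spodNormMax k α γ b) := by
  rw [← iSup_eq_mul_spodNormMax hc]
  exact korobovNorm_le hγ hF hper fun u => h (blockIndex u α)

end Assembly

lemma constS_le_geom_sum {ξ τ ρ : ℝ} {R : ℕ → ℝ} {L : ℕ} (hξ : 0 < ξ) (hτ : 0 < τ)
    (hR_pos : ∀ ℓ, 1 ≤ ℓ → ℓ ≤ L → 0 < R ℓ) (hRρ : ∀ ℓ, 1 ≤ ℓ → ℓ ≤ L - 1 → R ℓ ≤ ρ) :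
    constS ξ τ R L ≤ τ * ∑ k ∈ Finset.range L, (ξ * τ * ρ) ^ k := by
  refine mul_le_mul_of_nonneg_left (Finset.sum_le_sum fun k hk => ?_) hτ.le
  rw [Finset.mem_range] at hk
  calc constP ξ τ R k ≤ ∏ t ∈ Finset.Icc 1 k, (ξ * τ * ρ) := by
        refine Finset.prod_le_prod (fun t ht => ?_) fun t ht => ?_ <;> rw [Finset.mem_Icc] at ht
        · have := hR_pos t ht.1 (by omega)
          positivity
        · exact mul_le_mul_of_nonneg_left (hRρ t ht.1 (by omega)) (by positivity)
    _ = (ξ * τ * ρ) ^ k := by simp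

end DNNReg

theorem mainTheorem3
    -- network: widths `d 0 = s, …, d (L+1) = N_obs`, depth `L`, parameters, activation
    (d : ℕ → ℕ) (L : ℕ) (hL : 1 ≤ L) (θ : NetParams d) (σ : ℝ → ℝ)
    -- the three bounding sequences
    (β : Fin (d 0) → ℝ) (R : ℕ → ℝ) (ξ τ : ℝ)
    (hβ_pos : ∀ j, 0 < β j) (hR_pos : ∀ ℓ, 1 ≤ ℓ → ℓ ≤ L → 0 < R ℓ) (hξ : 0 < ξ) (hτ : 0 < τ)
    (hβ : ∀ p j, |θ.W 0 p j| ≤ β j)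
    (hR : ∀ ℓ, 1 ≤ ℓ → ℓ ≤ L → ∀ p, ∑ q, |θ.W ℓ p q| ≤ R ℓ)
    (hσ : ContDiff ℝ ∞ σ)
    (hσA : ∀ n : ℕ, 1 ≤ n → ∀ x : ℝ, |iteratedDeriv n σ x| ≤ ξ * τ ^ n * (n ! : ℝ))
    -- the restrictions
    (b : Fin (d 0) → ℝ) (C : ℝ) (hC : 0 < C) (ρ : ℝ) (hρ : 0 < ρ)
    (hRρ : ∀ ℓ, 1 ≤ ℓ → ℓ ≤ L - 1 → R ℓ ≤ ρ)
    (hβb : ∀ j, β j ≤ b j / constS ξ τ R L)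
    -- the weights
    (γ : Finset (Fin (d 0)) → ℝ) (hγ : ∀ u, 0 < γ u) :
    -- bound on `S_L`
    ((ξ * τ * ρ = 1 → constS ξ τ R L ≤ τ * L) ∧
      (ξ * τ * ρ ≠ 1 → constS ξ τ R L ≤ τ * (((ξ * τ * ρ) ^ L - 1) / (ξ * τ * ρ - 1)))) ∧
    -- (a) non-periodic case
    (constC ξ τ R L (dnn θ σ L) ≤ C →
      HasPODBound C b (dnn θ σ L) ∧
      ∀ G : (Fin (d 0) → ℝ) → (Fin (d (L + 1)) → ℝ), HasPODBound C b G →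
        ∀ p : Fin (d (L + 1)),
          max (sobolevNorm 1 γ (fun y => G y p) ^ 2)
              (sobolevNorm 1 γ (fun y => dnn θ σ L y p) ^ 2)
            ≤ C ^ 2 * podNormSum 0 γ b ∧
          sobolevNorm 1 γ (fun y => (G y p - dnn θ σ L y p) ^ 2) ^ 2
            ≤ 16 * C ^ 4 * podNormSum 1 γ b) ∧
    -- (b) and (c) periodic case
    (constC ξ τ R L (periodicDnn θ σ L) ≤ C →
      HasPeriodicSPODBound C b (periodicDnn θ σ L) ∧
      ∀ G : (Fin (d 0) → ℝ) → (Fin (d (L + 1)) → ℝ), HasPeriodicSPODBound C b G →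
        ∀ p : Fin (d (L + 1)),
          -- (b) Hilbert norm
          (∀ α : ℕ, 1 ≤ α →
            max (sobolevNorm α γ (fun y => G y p) ^ 2)
                (sobolevNorm α γ (fun y => periodicDnn θ σ L y p) ^ 2)
              ≤ C ^ 2 * spodNormSum 0 α γ b ∧
            sobolevNorm α γ (fun y => (G y p - periodicDnn θ σ L y p) ^ 2) ^ 2
              ≤ 16 * C ^ 4 * spodNormSum 1 α γ b) ∧
          -- (c) non-Hilbert norm: its Fourier form and its form in mixed derivatives
          (∀ α : ℕ, 2 ≤ α →
            (max (korobovNorm α γ (fun y => G y p))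
                 (korobovNorm α γ (fun y => periodicDnn θ σ L y p))
               ≤ ENNReal.ofReal (C * spodNormMax 0 α γ b) ∧
             korobovNorm α γ (fun y => (G y p - periodicDnn θ σ L y p) ^ 2)
               ≤ ENNReal.ofReal (4 * C ^ 2 * spodNormMax 1 α γ b)) ∧
            (max (korobovDerivNorm α γ (fun y => G y p))
                 (korobovDerivNorm α γ (fun y => periodicDnn θ σ L y p))
               ≤ C * spodNormMax 0 α γ b ∧
             korobovDerivNorm α γ (fun y => (G y p - periodicDnn θ σ L y p) ^ 2)
               ≤ 4 * C ^ 2 * spodNormMax 1 α γ b))) := by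
  refine ⟨⟨fun h => ?_, fun h => ?_⟩, fun hCL => ?_, fun hCL => ?_⟩
  · simpa [h] using constS_le_geom_sum hξ hτ hR_pos hRρ
  · rw [← geom_sum_eq h]
    exact constS_le_geom_sum hξ hτ hR_pos hRρ
  · have hF : HasPODBound C b (dnn θ σ L) :=
      hasPODBound_dnn hL hβ_pos hR_pos hξ hτ hβ hR hσ hσA hC hβb hCL
    refine ⟨hF, fun G hG p => ⟨max_le ?_ ?_, ?_⟩⟩
    · exact sobolevNorm_one_sq_le_podNormSum hγ fun ν => hG.2 ν p
    · exact sobolevNorm_one_sq_le_podNormSum hγ fun ν => hF.2 ν p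
    · refine (sobolevNorm_one_sq_le_podNormSum hγ fun ν y hy =>
        hF.sub_sq hG p ν hy).trans_eq ?_
      ring
  · have hF : HasPeriodicSPODBound C b (periodicDnn θ σ L) :=
      hasPeriodicSPODBound_periodicDnn hL hβ_pos hR_pos hξ hτ hβ hR hσ hσA hC hβb hCL
    have hC4 : 0 ≤ 4 * C ^ 2 := by positivity
    refine ⟨hF, fun G hG p => ⟨fun α _ => ⟨max_le ?_ ?_, ?_⟩,
      fun α _ => ⟨⟨max_le ?_ ?_, ?_⟩, max_le ?_ ?_, ?_⟩⟩⟩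
    · exact sobolevNorm_sq_le_spodNormSum hγ fun ν => hG.2.2 ν p
    · exact sobolevNorm_sq_le_spodNormSum hγ fun ν => hF.2.2 ν p
    · refine (sobolevNorm_sq_le_spodNormSum hγ fun ν y hy =>
        hF.sub_sq hG p ν hy).trans_eq ?_
      ring
    · exact korobovNorm_le_spodNormMax hγ hC.le (contDiff_pi.1 hG.1 p)
        (fun j y => by rw [hG.2.1]) fun ν => hG.2.2 ν p
    · exact korobovNorm_le_spodNormMax hγ hC.le (contDiff_pi.1 hF.1 p)
        (fun j y => by rw [hF.2.1]) fun ν => hF.2.2 ν p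
    · exact korobovNorm_le_spodNormMax hγ hC4
        (((contDiff_pi.1 hG.1 p).sub (contDiff_pi.1 hF.1 p)).pow 2)
        (fun j y => by rw [hG.2.1, hF.2.1]) fun ν y hy => hF.sub_sq hG p ν hy
    · exact korobovDerivNorm_le_spodNormMax hγ hC.le fun ν => hG.2.2 ν p
    · exact korobovDerivNorm_le_spodNormMax hγ hC.le fun ν => hF.2.2 ν p
    · exact korobovDerivNorm_le_spodNormMax hγ hC4 fun ν y hy => hF.sub_sq hG p ν hy
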